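/- **Setting.** Fix $\eta\in(0,1)$ and $p\in(\tfrac12,1-\tfrac{\eta}{2})$, a comparison granularity $\Delta>0$ and a noise scale $\gamma>0$. Let $\theta^*\in[-\beta_\Theta,\beta_\Theta]$ be the true parameter, with $\theta^*>0$. Let $d$ be a distance function on $\mathbb R$, that is, a metric such that $d(x,y)<d(x,z)$ and $d(y,z)<d(x,z)$ whenever $x<y<z$, and let $u(\theta)=-d(\theta,\theta^*)$. For $\theta\in[-\beta_\Theta,\beta_\Theta]$ let $c^-_\Delta(\theta)<\theta<c^+_\Delta(\theta)$ be points with $d(c^\pm_\Delta(\theta),\theta)=\Delta/2$. When a human compares the two options at $\theta$, $c^+_\Delta(\theta)$ is chosen (answer $+1$) if $u(c^+_\Delta(\theta))+\xi^+>u(c^-_\Delta(\theta))+\xi^-$, and $c^-_\Delta(\theta)$ is chosen (answer $-1$) otherwise; here $\xi^\pm$ are Gumbel variables of scale $\gamma$ (distribution function $x\mapsto\exp(-e^{-x/\gamma})$), and all noise variables are independent. *Test at $\theta$:* collect answers at $\theta$ until the first $m\ge1$ with $|S_m|\ge\hbar_m:=\big(2m(\ln(m+1)-\ln\eta)\big)^{1/2}$,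 where $S_m$ is the sum of the first $m$ answers; the outcome is $Z=\operatorname{sign}(S_m)\in\{+1,-1\}$ for this $m$. If there is no such $m$, the test never ends and the procedure stays at $\theta$ for ever. *Bisection:* start with a probability density $\rho_0$ on $[-\beta_\Theta,\beta_\Theta]$ that is positive everywhere, with distribution $\mu_0$. At step $k\ge 0$ let $\theta_k$ be the median of $\rho_k$ and run a test with fresh noise at $\theta_k$, with outcome $Z_k$. If $Z_k=+1$, put $\rho_{k+1}=2p\,\rho_k$ on $\{\theta'\ge\theta_k\}$ and $\rho_{k+1}=2(1-p)\,\rho_k$ on $\{\theta'<\theta_k\}$; if $Z_k=-1$, exchange the two factors. If the test at $\theta_k$ never ends, put $\theta_j=\theta_k$ for all $j\ge k$. For $a\in(0,\theta^*+\beta_\Theta)$ let $A=[-\beta_\Theta,\theta^*-a]$, $A'=[\theta^*+a,\beta_\Theta]$ (possibly empty), and $$T(a)=\inf\{k'\ge0:\theta_k\notin A\ \ \forall k\ge k'\},\qquad T'(a)=\inf\{k'\ge0:\theta_k\notin A'\ \ \forall k\ge k'\},\qquad \psi(a)=\max\{T(a),T'(a)\},$$ where $\inf\emptyset=\infty$.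 **Proposition.** There are constants $r_1,r_2,r_R,\alpha,\beta_1,\beta_2>0$, where $r_2$ depends only on $\eta$ and $p$; $r_1,r_R,\alpha$ depend only on $\eta,p,\Delta,\gamma$; and $\beta_1,\beta_2$ depend only on $\eta,p,\Delta,\gamma,\theta^*$ (in particular none of them depends on $a$), with the following property. Let $a\in(0,\theta^*+\beta_\Theta)$ and let $\varsigma\le 1$ be a real number such that $$\mu_0\big((\theta^*-a,\theta^*]\big)\ge a^{\varsigma},\qquad\text{and}\qquad \mu_0\big([\theta^*,\theta^*+a)\big)\ge a^{\varsigma}\ \text{ if } \theta^*+a\le\beta_\Theta.$$ Then $$\mathbb E[\psi(a)]\le\frac{4\theta^*}{r_2\,\alpha\,a^{\varsigma}}+\frac{4\beta_1}{r_1}+\frac{2\beta_2}{r_R}.$$ In particular $\psi(a)$ is almost surely finite. -/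

import Mathlib

open MeasureTheory ProbabilityTheory Set
open scoped ENNReal

namespace BisectionMedians

/-- A distance function on the line: a metric for which the distance to a fixed point increases
strictly when one moves away from that point, on either side (so `-d · y` is unimodal with peak
`y`). -/
structure IsDistance (d : ℝ → ℝ → ℝ) : Prop where
  eq_zero_iff : ∀ x y, d x y = 0 ↔ x = y
  symm : ∀ x y, d x y = d y x
  triangle : ∀ x y z, d x z ≤ d x y + d y z
  lt_of_between : ∀ x y z, x < y → y < z → d x y < d x z ∧ d y z < d x z

/-- `cm x` and `cp x` are the two options shown to the human at the query point `x`: they lie to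
the left and to the right of `x`, both at distance `Δ / 2`. -/
def IsComparisonPair (d : ℝ → ℝ → ℝ) (Δ β : ℝ) (cm cp : ℝ → ℝ) : Prop :=
  ∀ x ∈ Icc (-β) β, cm x < x ∧ x < cp x ∧ d (cm x) x = Δ / 2 ∧ d (cp x) x = Δ / 2

/-- `X` has the (centred) Gumbel distribution with scale `γ`. -/
def IsGumbel {Ω : Type*} [MeasurableSpace Ω] (P : Measure Ω) (γ : ℝ) (X : Ω → ℝ) : Prop :=
  ∀ x : ℝ, P {ω | X ω ≤ x} = ENNReal.ofReal (Real.exp (-Real.exp (-x / γ)))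

/-- The utility of the parameter `x` when the true parameter is `θs`. -/
def utility (d : ℝ → ℝ → ℝ) (θs x : ℝ) : ℝ := -d x θs

open Classical in
/-- One answer of the human at the query point `x`: `1` if the right option has the larger
noisy utility, `-1` otherwise. The noise of the right option is `e true`, that of the left option
is `e false`. -/
noncomputable def answer (d : ℝ → ℝ → ℝ) (θs : ℝ) (cm cp : ℝ → ℝ) (x : ℝ) (e : Bool → ℝ) : ℝ :=
  if utility d θs (cm x) + e false < utility d θs (cp x) + e true then 1 else -1

/-- The random walk with steps `z 0, z 1, …`. -/
noncomputable def walk (z : ℕ → ℝ) (m : ℕ) : ℝ := ∑ i ∈ Finset.range m, z i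

/-- The boundary of the sequential test of power one. -/
noncomputable def boundary (η : ℝ) (m : ℕ) : ℝ :=
  Real.sqrt (2 * m * (Real.log (m + 1) - Real.log η))

open Classical in
/-- The outcome of the test of power one on the answers `z`: the sign of the walk at the first time
`m ≥ 1` with `|walk z m| ≥ boundary η m`, and `0` (no decision) if there is no such time. -/
noncomputable def verdict (η : ℝ) (z : ℕ → ℝ) : SignType :=
  if h : ∃ m : ℕ, 1 ≤ m ∧ boundary η m ≤ |walk z m| then SignType.sign (walk z (Nat.find h)) else 0

/-- The measure on `[-β, β]` with density `ρ`. -/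
noncomputable def densityMeasure (β : ℝ) (ρ : ℝ → ℝ) : Measure ℝ :=
  (volume.restrict (Icc (-β) β)).withDensity (fun y => ENNReal.ofReal (ρ y))

/-- `ρ` is a probability density on `[-β, β]`, positive everywhere there. -/
structure IsPriorDensity (β : ℝ) (ρ : ℝ → ℝ) : Prop where
  measurable : Measurable ρ
  pos : ∀ y ∈ Icc (-β) β, 0 < ρ y
  mass : densityMeasure β ρ univ = 1

/-- The median of the distribution on `[-β, β]` with density `ρ`. -/
noncomputable def median (β : ℝ) (ρ : ℝ → ℝ) : ℝ :=
  sInf {x | x ∈ Icc (-β) β ∧ 1 / 2 ≤ densityMeasure β ρ (Iic x)}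

open Classical in
/-- The update of the density `ρ` after the verdict `z` at the query point `x`. -/
noncomputable def update (p x : ℝ) (z : SignType) (ρ : ℝ → ℝ) (y : ℝ) : ℝ :=
  if z = 1 then (if x ≤ y then 2 * p * ρ y else 2 * (1 - p) * ρ y)
  else (if x ≤ y then 2 * (1 - p) * ρ y else 2 * p * ρ y)

/-- The state of the bisection: the current density, and whether all tests so far have ended. A test
that never ends keeps the procedure at its query point for ever. -/
structure State where
  density : ℝ → ℝ
  running : Prop

open Classical in
/-- One horizontal move: query the median with a test of power one, then update the density. -/
noncomputable def step (η p β : ℝ) (d : ℝ → ℝ → ℝ) (θs : ℝ) (cm cp : ℝ → ℝ) (e : ℕ → Bool → ℝ)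
    (s : State) : State :=
  let x := median β s.density
  let z := verdict η (fun i => answer d θs cm cp x (e i))
  if s.running ∧ z ≠ 0 then ⟨update p x z s.density, True⟩ else ⟨s.density, False⟩

/-- The state after `k` horizontal moves; `e k i` is the pair of noises in the `i`-th comparison of
the `k`-th test. -/
noncomputable def run (η p β : ℝ) (d : ℝ → ℝ → ℝ) (θs : ℝ) (cm cp : ℝ → ℝ) (ρ₀ : ℝ → ℝ)
    (e : ℕ → ℕ → Bool → ℝ) : ℕ → State
  | 0 => ⟨ρ₀, True⟩
  | k + 1 => step η p β d θs cm cp (e k) (run η p β d θs cm cp ρ₀ e k)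

/-- The `k`-th query point. -/
noncomputable def query (η p β : ℝ) (d : ℝ → ℝ → ℝ) (θs : ℝ) (cm cp : ℝ → ℝ) (ρ₀ : ℝ → ℝ)
    (e : ℕ → ℕ → Bool → ℝ) (k : ℕ) : ℝ :=
  median β (run η p β d θs cm cp ρ₀ e k).density

/-- The first time from which on the sequence `x` stays in `S` (`∞` if there is none). -/
noncomputable def settleTime (x : ℕ → ℝ) (S : Set ℝ) : ℝ≥0∞ :=
  ⨅ (n : ℕ) (_ : ∀ k, n ≤ k → x k ∈ S), (n : ℝ≥0∞)

/-- The time from which on the sequence `x` in `[-β, β]` never reenters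
`[-β, θs - a] ∪ [θs + a, β]`, as the maximum of the times for the left and for the right part. -/
noncomputable def exitTime (β θs a : ℝ) (x : ℕ → ℝ) : ℝ≥0∞ :=
  max (settleTime x (Ioc (θs - a) θs ∪ Ioc θs β)) (settleTime x (Icc (θs + a) β)ᶜ)

end BisectionMedians

/-! ### One-step contraction of a Lyapunov function. -/

namespace BisectionMedians

/-! Let `s` and `t` be the posterior masses of `[-β, θs - a]` and `[-β, θs]`. Updating at the median
changes both by the same piecewise linear map `push`, so the left half of the problem is a random
recursion for the pair `(s, t)`. The median lies in the left tail only if `1 / 2 ≤ s`, and then `s /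
(t - s) ≥ 1`. The right half is the mirror image, with `1 - s` and `1 - t` formed from the masses
below `θs + a` and `θs`.

The heart is `exists_potential_contract`: `potential`, a corrected form of `s / (t - s)`, contracts
in mean by a fixed factor at every step. Away from `θs` the wrong verdict has probability at most `η
/ 2 < 1 - p`, which makes `shrink p (η / 2) < 1`. If `t < 1 / 2`, both masses are scaled alike and
the ratio stands still, but `1 / t` contracts in mean; hence the term with `δ`. If `t = 1 / 2`, the
median is `θs`, and the two verdicts together have probability at most `η < 1`. If `t > 1 / 2`, the
ratio contracts at a rate bounded below, unless only a small share of the target mass lies beyond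
the median. In that exceptional case a wrong verdict, of probability at least `ε`, leads to a state
with a large share; the discount `δ'` granted to such states supplies the missing contraction.

The bounds on verdicts (`outcomeBounds`) come from three sources. The upper bound compares fair coin
tossing with the mixture of all coins under a uniformly distributed bias: at the boundary the
mixture is at least `1 / η` times as likely, the stopped paths have total mixture mass at most one,
and symmetry halves this. The lower bound comes from a fixed number of wrong answers in a row, which
bounded utility differences and Gumbel noise make uniformly possible. Away from `θs` the strong law
ends the test. At `θs` it may never end, but a run stuck there is outside both tails.

Given a history of verdicts the query point is deterministic and the next test uses fresh noise, so
expectations are sums over a binary tree. If `m` is a lower bound for the prior mass next to `θs`,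
the potential starts below `1 / m ^ 2`, and step `k` is in a tail with probability at most `2 * ν ^
(4 * k) / m ^ 2`. A fourth root and a geometric sum bound the expected exit time by a multiple of `1
/ √m`; finally `1 / √m ≤ θs / m + 1 / θs`. -/

/-- The update of the distribution function at a fixed point when the mass below the median is
multiplied by `2 * r` and the mass above it by `2 * (1 - r)`. -/
noncomputable def push (r x : ℝ) : ℝ := 2 * r * min x (1 / 2) + 2 * (1 - r) * max (x - 1 / 2) 0

open Classical in
/-- The Lyapunov function of the bisection; `s` and `t` are the masses beyond the boundary of the
target interval and beyond the true parameter. -/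
noncomputable def potential (δ δ' c s t : ℝ) : ℝ :=
  s / (t - s) * (1 + δ * (1 / t - 1) - if c * (t - s) ≤ t - 1 / 2 then δ' else 0)

lemma push_of_le {r x : ℝ} (h : x ≤ 1 / 2) : push r x = 2 * r * x := by
  rw [push, min_eq_left h, max_eq_right (by linarith)]; ring

lemma push_of_ge {r x : ℝ} (h : 1 / 2 ≤ x) : push r x = r + 2 * (1 - r) * (x - 1 / 2) := by
  rw [push, min_eq_right h, max_eq_left (by linarith)]; ring

lemma push_lt_push {r x y : ℝ} (h0 : 0 < r) (h1 : r < 1) (h : x < y) : push r x < push r y := by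
  rcases le_total y (1 / 2) with hy | hy
  · rw [push_of_le hy, push_of_le (h.le.trans hy)]; nlinarith
  · rw [push_of_ge hy]
    rcases le_total x (1 / 2) with hx | hx
    · rw [push_of_le hx]
      rcases hy.lt_or_eq with hy | hy <;> nlinarith
    · rw [push_of_ge hx]; nlinarith

lemma push_nonneg {r x : ℝ} (h0 : 0 < r) (h1 : r < 1) (h : 0 ≤ x) : 0 ≤ push r x := by
  have : 0 ≤ min x (1 / 2) := le_min h (by norm_num)
  have h2 : 0 ≤ max (x - 1 / 2) 0 := le_max_right _ _
  have := mul_nonneg h0.le this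
  have := mul_nonneg (sub_nonneg.2 h1.le) h2
  rw [push]; linarith

lemma push_le_one {r x : ℝ} (h0 : 0 < r) (h1 : r < 1) (h : x ≤ 1) : push r x ≤ 1 := by
  rcases le_total x (1 / 2) with hx | hx
  · rw [push_of_le hx]; nlinarith
  · rw [push_of_ge hx]; nlinarith

lemma potential_le {δ δ' c s t : ℝ} (hs : 0 ≤ s) (hst : s < t) (hδ' : 0 ≤ δ') :
    potential δ δ' c s t ≤ s / (t - s) * (1 + δ * (1 / t - 1)) := by
  have : 0 ≤ s / (t - s) := div_nonneg hs (by linarith)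
  rw [potential]
  apply mul_le_mul_of_nonneg_left _ this
  split_ifs <;> linarith

lemma le_potential {δ δ' c s t : ℝ} (hs : 0 ≤ s) (hst : s < t) (ht : t ≤ 1) (hδ : 0 ≤ δ)
    (hδ' : 0 ≤ δ') : s / (t - s) * (1 - δ') ≤ potential δ δ' c s t := by
  have : 0 ≤ s / (t - s) := div_nonneg hs (by linarith)
  rw [potential]
  apply mul_le_mul_of_nonneg_left _ this
  have h1 : 1 ≤ 1 / t := (one_le_div (by linarith)).2 ht
  have : 0 ≤ δ * (1 / t - 1) := mul_nonneg hδ (by linarith)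
  split_ifs <;> linarith

/-- The worst case gives the larger value `b` its full permitted weight `e` and puts all remaining
probability on `a`. -/
lemma mix_le_mix {x y e a b : ℝ} (hy : y ≤ e) (hxy : x + y ≤ 1) (ha : 0 ≤ a) (hab : a ≤ b) :
    x * a + y * b ≤ (1 - e) * a + e * b := by
  nlinarith

/-- The expected factor by which the mass on the wrong side changes, compared with the mass on the
right side. -/
noncomputable def shrink (p e : ℝ) : ℝ := (1 - e) * ((1 - p) / p) + e * (p / (1 - p))

lemma shrink_lt_one {p e : ℝ} (hp : 1 / 2 < p) (he : 0 ≤ e) (hpe : p < 1 - e) : shrink p e < 1 := by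
  have h1 : 0 < p := by linarith
  have h2 : 0 < 1 - p := by linarith
  have : shrink p e - 1 = (2 * p - 1) * (e - (1 - p)) / (p * (1 - p)) := by
    rw [shrink]; field_simp; ring
  have : (2 * p - 1) * (e - (1 - p)) / (p * (1 - p)) < 0 :=
    div_neg_of_neg_of_pos (by nlinarith) (by positivity)
  linarith

lemma shrink_nonneg {p e : ℝ} (hp : 1 / 2 < p) (he : 0 ≤ e) (hpe : p < 1 - e) : 0 ≤ shrink p e := by
  have h1 : 0 < p := by linarith
  have h2 : 0 < 1 - p := by linarith
  have h3 : 0 ≤ 1 - e := by linarith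
  rw [shrink]; positivity

/-- While the median is on the far side of the true parameter, the potential contracts. -/
lemma potential_contract_far {p e δ δ' c s t x y : ℝ} (hp : 1 / 2 < p) (he : 0 ≤ e)
    (hpe : p < 1 - e) (hδ : 0 ≤ δ) (hδ1 : δ ≤ 1) (hδ' : 0 ≤ δ') (hc : 0 ≤ c) (hs : 0 ≤ s)
    (hst : s < t) (ht : t < 1 / 2) (hx : 0 ≤ x) (hy : 0 ≤ y) (hxy : x + y ≤ 1) (hxe : x ≤ e) :
    x * potential δ δ' c (push (1 - p) s) (push (1 - p) t)
      + y * potential δ δ' c (push p s) (push p t)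
      ≤ (1 - δ * ((1 - shrink p e) / 2)) * potential δ δ' c s t := by
  have h1 : 0 < p := by linarith
  have h2 : 0 < 1 - p := by linarith
  have ht0 : 0 < t := by linarith
  have hd : 0 < t - s := by linarith
  have hR : 0 ≤ s / (t - s) := div_nonneg hs hd.le
  have e1 : potential δ δ' c s t = s / (t - s) * (1 + δ * (1 / t - 1)) := by
    rw [potential, if_neg, sub_zero]
    have : 0 ≤ c * (t - s) := by positivity
    linarith
  have key : ∀ r : ℝ, 0 < r → r < 1 → potential δ δ' c (push r s) (push r t)
      ≤ s / (t - s) * (1 - δ + δ / t * (1 / (2 * r))) := by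
    intro r hr hr1
    refine (potential_le (push_nonneg hr hr1 hs) (push_lt_push hr hr1 hst) hδ').trans_eq ?_
    rw [push_of_le ht.le, push_of_le (hst.trans ht).le]
    have : 2 * r * t - 2 * r * s ≠ 0 := by
      rw [← mul_sub]; positivity
    field_simp
    ring
  have k1 := mul_le_mul_of_nonneg_left (key (1 - p) h2 (by linarith)) hx
  have k2 := mul_le_mul_of_nonneg_left (key p h1 (by linarith)) hy
  -- The ratio `s / (t - s)` is the same after either verdict, so only the mean of `1 / (2 * r)`,
  -- the factor of `1 / t`, counts. In the worst case it equals `(1 + shrink p e) / 2`.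
  have k3 : y * (1 / (2 * p)) + x * (1 / (2 * (1 - p)))
      ≤ (1 - e) * (1 / (2 * p)) + e * (1 / (2 * (1 - p))) := by
    apply mix_le_mix hxe (by linarith) (by positivity)
    exact one_div_le_one_div_of_le (by linarith) (by linarith)
  have k4 : (1 - e) * (1 / (2 * p)) + e * (1 / (2 * (1 - p))) = (1 + shrink p e) / 2 := by
    rw [shrink]; field_simp; ring
  rw [k4] at k3
  rw [e1]
  have k5 : x * (1 - δ + δ / t * (1 / (2 * (1 - p)))) + y * (1 - δ + δ / t * (1 / (2 * p)))
      ≤ (1 - δ * ((1 - shrink p e) / 2)) * (1 + δ * (1 / t - 1)) := by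
    have hsh := shrink_lt_one hp he hpe
    have : δ / t * (y * (1 / (2 * p)) + x * (1 / (2 * (1 - p)))) ≤ δ / t * ((1 + shrink p e) / 2) :=
      mul_le_mul_of_nonneg_left k3 (by positivity)
    have : (x + y) * (1 - δ) ≤ 1 - δ := by nlinarith
    have h3 : 1 ≤ 1 / t := (one_le_div ht0).2 (by linarith)
    have h4 : 1 + δ * (1 / t - 1) ≤ 1 / t := by nlinarith
    have h5 : δ * ((1 - shrink p e) / 2) * (1 + δ * (1 / t - 1))
        ≤ δ * ((1 - shrink p e) / 2) * (1 / t) :=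
      mul_le_mul_of_nonneg_left h4 (mul_nonneg hδ (by linarith))
    have h6 : x * (1 - δ + δ / t * (1 / (2 * (1 - p)))) + y * (1 - δ + δ / t * (1 / (2 * p)))
        = (x + y) * (1 - δ) + δ / t * (y * (1 / (2 * p)) + x * (1 / (2 * (1 - p)))) := by ring
    have h7 : (1 - δ * ((1 - shrink p e) / 2)) * (1 + δ * (1 / t - 1))
        = 1 - δ + δ * (1 / t) - δ * ((1 - shrink p e) / 2) * (1 + δ * (1 / t - 1)) := by ring
    have h8 : δ * ((1 - shrink p e) / 2) * (1 / t) + δ / t * ((1 + shrink p e) / 2)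
        = δ * (1 / t) := by ring
    linarith
  have := mul_le_mul_of_nonneg_left k5 hR
  linarith

/-- The bound on the potential after a step from a state whose median is not on the far side. -/
lemma potential_push_le {p r δ δ' c s t : ℝ} (hp : 1 / 2 < p) (hp1 : p < 1) (hr : 1 - p ≤ r)
    (hr' : r ≤ p) (hδ : 0 ≤ δ) (hδ' : 0 ≤ δ') (hs : 0 ≤ s) (hst : s < t) (ht : 1 / 2 ≤ t) :
    potential δ δ' c (push r s) (push r t)
      ≤ push r s / (push r t - push r s) * (1 + δ * (p / (1 - p))) := by
  have h2 : 0 < 1 - p := by linarith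
  refine (potential_le (push_nonneg (by linarith) (by linarith) hs)
    (push_lt_push (by linarith) (by linarith) hst) hδ').trans ?_
  apply mul_le_mul_of_nonneg_left
  · have : 1 / push r t ≤ 1 / (1 - p) := by
      apply one_div_le_one_div_of_le h2
      rw [push_of_ge ht]; nlinarith
    have h3 : p / (1 - p) = 1 / (1 - p) - 1 := by field_simp; ring
    rw [h3]
    nlinarith
  · have := push_lt_push (r := r) (by linarith) (by linarith) hst
    exact div_nonneg (push_nonneg (by linarith) (by linarith) hs) (by linarith)

/-- An answer pointing away from the true parameter leads to a state where the ratio contracts. -/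
lemma potential_push_down_le {p δ δ' s t : ℝ} (hp : 1 / 2 < p) (hp1 : p < 1)
    (hδ : 0 ≤ δ) (hs : 0 ≤ s) (hst : s < t) (ht : 1 / 2 ≤ t) (ht1 : t ≤ 1) :
    potential δ δ' (p - 1 / 2) (push p s) (push p t)
      ≤ push p s / (push p t - push p s) * (1 + δ * (p / (1 - p)) - δ') := by
  have h1 : 0 < p := by linarith
  have h2 : 0 < 1 - p := by linarith
  have hpt : push p t = p + 2 * (1 - p) * (t - 1 / 2) := push_of_ge ht
  have hlt := push_lt_push h1 hp1 hst
  have hps0 := push_nonneg h1 hp1 hs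
  have hpt1 := push_le_one h1 hp1 ht1
  have hpos : 0 ≤ (1 - p) * (t - 1 / 2) := mul_nonneg h2.le (by linarith)
  -- The discount applies after this push: `push p t ≥ p`, so the mass beyond the median is at least
  -- `p - 1 / 2`, while the target mass is at most `1`. This dictates the value `p - 1 / 2` of the
  -- threshold `c`.
  rw [potential, if_pos]
  · apply mul_le_mul_of_nonneg_left _ (div_nonneg hps0 (by linarith))
    have : 1 / push p t ≤ 1 / (1 - p) := one_div_le_one_div_of_le h2 (by linarith)
    have h3 : p / (1 - p) = 1 / (1 - p) - 1 := by field_simp; ring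
    rw [h3]
    nlinarith
  · nlinarith

/-- With the median at the true parameter no direction is favoured and the ratio stands still, since
`s` and `t` are at most `1 / 2`. What contracts is total probability: the verdicts share at most `2
* e < 1`, and runs whose test never ends drop out. -/
lemma potential_contract_at {p e δ δ' c s t x y : ℝ} (hp : 1 / 2 < p) (he : 0 ≤ e)
    (hpe : p < 1 - e) (hδ : 0 ≤ δ) (hδ' : 0 ≤ δ') (hc : 0 < c) (hs : 0 ≤ s)
    (hst : s < t) (ht : t = 1 / 2) (hx : 0 ≤ x) (hy : 0 ≤ y) (hxe : x ≤ e) (hye : y ≤ e) :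
    x * potential δ δ' c (push (1 - p) s) (push (1 - p) t)
      + y * potential δ δ' c (push p s) (push p t)
      ≤ (2 * e * (1 + δ * (p / (1 - p)))) * potential δ δ' c s t := by
  have h1 : 0 < p := by linarith
  have h2 : 0 < 1 - p := by linarith
  have hd : 0 < t - s := by linarith
  have hR : 0 ≤ s / (t - s) := div_nonneg hs hd.le
  have e1 : s / (t - s) ≤ potential δ δ' c s t := by
    rw [potential, if_neg, sub_zero]
    · apply le_mul_of_one_le_right hR
      rw [ht]; norm_num; exact hδ
    · have : 0 < c * (t - s) := by positivity
      linarith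
  have e2 : ∀ r : ℝ, 0 < r → push r s / (push r t - push r s) = s / (t - s) := by
    intro r hr
    rw [push_of_le ht.le, push_of_le (by linarith), ← mul_sub, mul_div_mul_left _ _ (by positivity)]
  have k1 := potential_push_le (p := p) (r := 1 - p) (c := c) hp (by linarith) le_rfl (by linarith)
    hδ hδ' hs hst ht.ge
  have k2 := potential_push_le (p := p) (r := p) (c := c) hp (by linarith) (by linarith) le_rfl
    hδ hδ' hs hst ht.ge
  rw [e2 _ h2] at k1
  rw [e2 _ h1] at k2
  have hK : 0 ≤ 1 + δ * (p / (1 - p)) := by positivity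
  have hM : 0 ≤ s / (t - s) * (1 + δ * (p / (1 - p))) := by positivity
  calc _ ≤ e * (s / (t - s) * (1 + δ * (p / (1 - p)))) + e * (s / (t - s) * (1 + δ * (p / (1 - p)))) :=
        add_le_add ((mul_le_mul_of_nonneg_left k1 hx).trans (mul_le_mul_of_nonneg_right hxe hM))
          ((mul_le_mul_of_nonneg_left k2 hy).trans (mul_le_mul_of_nonneg_right hye hM))
    _ = (2 * e * (1 + δ * (p / (1 - p)))) * (s / (t - s)) := by ring
    _ ≤ _ := mul_le_mul_of_nonneg_left e1 (by positivity)

/-- The mass ratio contracts in expectation when the median is in the tail. -/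
lemma ratio_contract_tail {p e s t x y : ℝ} (hp : 1 / 2 < p) (he : 0 ≤ e)
    (hpe : p < 1 - e) (hs : 1 / 2 ≤ s) (hst : s < t) (ht : t ≤ 1)
    (hye : y ≤ e) (hxy : x + y ≤ 1) :
    x * (push (1 - p) s / (push (1 - p) t - push (1 - p) s))
      + y * (push p s / (push p t - push p s)) ≤ (1 - (1 - shrink p e) / 2) * (s / (t - s)) := by
  have h1 : 0 < p := by linarith
  have h2 : 0 < 1 - p := by linarith
  have hd : 0 < t - s := by linarith
  -- The target interval lies beyond the median and is scaled by `2 * (1 - r)`; relative to it, only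
  -- the half of the mass below the median changes, by the factor `r / (1 - r)`.
  have e2 : ∀ r : ℝ, 0 < r → r < 1 → push r s / (push r t - push r s)
      = (r / (1 - r) / 2 + (s - 1 / 2)) / (t - s) := by
    intro r hr hr1
    have h3 : 0 < 1 - r := by linarith
    rw [push_of_ge (hs.trans hst.le), push_of_ge hs]
    have : r + 2 * (1 - r) * (t - 1 / 2) - (r + 2 * (1 - r) * (s - 1 / 2)) = 2 * (1 - r) * (t - s) := by
      ring
    rw [this]
    field_simp
  rw [e2 _ h1 (by linarith), e2 _ h2 (by linarith)]
  have k := mix_le_mix (a := (1 - p) / p) (b := p / (1 - p)) hye hxy (by positivity)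
    (by rw [div_le_div_iff₀ h1 h2]; nlinarith)
  have k' : x * ((1 - p) / p / 2 + (s - 1 / 2)) + y * (p / (1 - p) / 2 + (s - 1 / 2))
      ≤ (1 - (1 - shrink p e) / 2) * s := by
    have : (x + y) * (s - 1 / 2) ≤ s - 1 / 2 := by nlinarith
    have h4 := shrink_lt_one hp he hpe
    have h5 : shrink p e = (1 - e) * ((1 - p) / p) + e * (p / (1 - p)) := rfl
    nlinarith
  calc _ = (x * ((1 - p) / p / 2 + (s - 1 / 2)) + y * (p / (1 - p) / 2 + (s - 1 / 2))) / (t - s) := by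
        rw [sub_sub_cancel]; ring
    _ ≤ (1 - (1 - shrink p e) / 2) * s / (t - s) := by gcongr
    _ = _ := by ring

/-- The mass ratio contracts in expectation when the median is in the target interval, at a rate
which depends on the part of the interval beyond the median. -/
lemma ratio_contract_target {p e s t x y : ℝ} (hp : 1 / 2 < p) (he : 0 ≤ e)
    (hpe : p < 1 - e) (hs0 : 0 ≤ s) (hs : s < 1 / 2) (ht : 1 / 2 < t)
    (hye : y ≤ e) (hxy : x + y ≤ 1) :
    x * (push (1 - p) s / (push (1 - p) t - push (1 - p) s))
      + y * (push p s / (push p t - push p s))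
      ≤ (1 - (1 - shrink p e) * ((t - 1 / 2) / (t - s))) * (s / (t - s)) := by
  have h1 : 0 < p := by linarith
  have h2 : 0 < 1 - p := by linarith
  have hst : s < t := by linarith
  have hd : 0 < t - s := by linarith
  set z := (t - 1 / 2) / (t - s) with hz
  have hz0 : 0 ≤ z := div_nonneg (by linarith) hd.le
  have hz1 : z ≤ 1 := (div_le_one hd).2 (by linarith)
  have hzt : t - 1 / 2 = z * (t - s) := by rw [hz]; field_simp
  have e2 : ∀ r : ℝ, 0 < r → r < 1 → push r s / (push r t - push r s)
      ≤ (1 - z + z * (r / (1 - r))) * (s / (t - s)) := by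
    intro r hr hr1
    have h3 : 0 < 1 - r := by linarith
    have hD : push r t - push r s = 2 * (t - s) * (r * (1 - z) + (1 - r) * z) := by
      rw [push_of_ge ht.le, push_of_le hs.le]
      linear_combination 2 * (1 - r) * hzt - 2 * r * hzt
    have hq : 0 < r * (1 - z) + (1 - r) * z := by
      rcases hz0.eq_or_lt with h | h
      · rw [← h]; linarith
      · have := mul_pos h3 h
        have := mul_nonneg hr.le (sub_nonneg.2 hz1)
        linarith
    rw [hD, push_of_le hs.le]
    -- Harmonic against arithmetic mean: a share `1 - z` of the target is scaled by `2 * r` and a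
    -- share `z` by `2 * (1 - r)`.
    have : r / (r * (1 - z) + (1 - r) * z) ≤ 1 - z + z * (r / (1 - r)) := by
      rw [div_le_iff₀ hq]
      have : (1 - z + z * (r / (1 - r))) * (r * (1 - z) + (1 - r) * z) - r
          = z * (1 - z) * (2 * r - 1) ^ 2 / (1 - r) := by
        field_simp; ring
      have : 0 ≤ z * (1 - z) * (2 * r - 1) ^ 2 / (1 - r) := by
        have := sub_nonneg.2 hz1
        positivity
      linarith
    calc 2 * r * s / (2 * (t - s) * (r * (1 - z) + (1 - r) * z))
        = r / (r * (1 - z) + (1 - r) * z) * (s / (t - s)) := by field_simp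
      _ ≤ _ := mul_le_mul_of_nonneg_right this (div_nonneg hs0 hd.le)
  have hR : 0 ≤ s / (t - s) := div_nonneg hs0 hd.le
  have hpos : ∀ r : ℝ, 0 < r → r < 1 → 0 ≤ push r s / (push r t - push r s) := fun r hr hr1 =>
    div_nonneg (push_nonneg hr hr1 hs0) (sub_nonneg.2 (push_lt_push hr hr1 hst).le)
  have hab : (1 - p) / p ≤ p / (1 - p) := by rw [div_le_div_iff₀ h1 h2]; nlinarith
  have hle : push (1 - p) s / (push (1 - p) t - push (1 - p) s)
      ≤ push p s / (push p t - push p s) := by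
    have hn := push_lt_push h2 (by linarith) hst
    have hm := push_lt_push h1 (by linarith) hst
    rw [div_le_div_iff₀ (by linarith) (by linarith)]
    rw [push_of_le hs.le, push_of_le hs.le, push_of_ge ht.le, push_of_ge ht.le]
    have : 0 ≤ s * (t - 1 / 2) * (2 * p - 1) := by
      apply mul_nonneg (mul_nonneg hs0 (by linarith)) (by linarith)
    nlinarith
  have k := mix_le_mix hye hxy (hpos _ h2 (by linarith)) hle
  have k1 := mul_le_mul_of_nonneg_left (e2 (1 - p) h2 (by linarith)) (by linarith : 0 ≤ 1 - e)
  have k2 := mul_le_mul_of_nonneg_left (e2 p h1 (by linarith)) he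
  rw [sub_sub_cancel] at k1
  have h5 : shrink p e = (1 - e) * ((1 - p) / p) + e * (p / (1 - p)) := rfl
  calc _ ≤ _ := k
    _ ≤ _ := add_le_add k1 k2
    _ = _ := by rw [h5]; ring

/-- Either the ratio itself contracts enough to absorb the corrections, or the median is so close to
the true parameter that the contraction comes from the discount `δ'` gained by a wrong verdict. The
two entries of the maximum are these two cases. -/
lemma potential_contract_near {p e ε δ δ' s t x y : ℝ} (hp : 1 / 2 < p) (he : 0 ≤ e)
    (hpe : p < 1 - e) (hδ : 0 ≤ δ) (hδ' : 0 ≤ δ') (hs : 0 ≤ s)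
    (hst : s < t) (ht : 1 / 2 < t) (ht1 : t ≤ 1) (hx : 0 ≤ x) (hy : 0 ≤ y) (hxy : x + y ≤ 1)
    (hye : y ≤ e) (hyε : ε ≤ y) (hδ'1 : δ' < 1) :
    x * potential δ δ' (p - 1 / 2) (push (1 - p) s) (push (1 - p) t)
      + y * potential δ δ' (p - 1 / 2) (push p s) (push p t)
      ≤ max ((1 + δ * (p / (1 - p))) * (1 - (1 - shrink p e) * (p - 1 / 2)) / (1 - δ'))
          (1 + δ * (p / (1 - p)) - δ' * ε) * potential δ δ' (p - 1 / 2) s t := by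
  have h1 : 0 < p := by linarith
  have h2 : 0 < 1 - p := by linarith
  have hd : 0 < t - s := by linarith
  have hR : 0 ≤ s / (t - s) := div_nonneg hs hd.le
  have hsh := shrink_lt_one hp he hpe
  have hsh0 := shrink_nonneg hp he hpe
  have hw0 : 0 ≤ (1 - shrink p e) * (p - 1 / 2) := mul_nonneg (by linarith) (by linarith)
  have hw1 : (1 - shrink p e) * (p - 1 / 2) ≤ (1 - shrink p e) / 2 := by
    have := mul_le_mul_of_nonneg_left (by linarith : p - 1 / 2 ≤ 1 / 2) (sub_nonneg.2 hsh.le)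
    linarith
  have hκ : 0 ≤ δ * (p / (1 - p)) := by positivity
  set K := 1 + δ * (p / (1 - p)) with hK
  have hK0 : 0 ≤ K := by linarith
  have k1 := potential_push_le (p := p) (r := 1 - p) (c := p - 1 / 2) hp (by linarith) le_rfl
    (by linarith) hδ hδ' hs hst ht.le
  have k2 := potential_push_le (p := p) (r := p) (c := p - 1 / 2) hp (by linarith) (by linarith)
    le_rfl hδ hδ' hs hst ht.le
  have kk := add_le_add (mul_le_mul_of_nonneg_left k1 hx) (mul_le_mul_of_nonneg_left k2 hy)
  have hφ := le_potential (c := p - 1 / 2) hs hst ht1 hδ hδ'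
  have hφ0 : 0 ≤ potential δ δ' (p - 1 / 2) s t :=
    (mul_nonneg hR (by linarith)).trans hφ
  -- The ratio dominates: passing between ratio and potential costs a factor `K` after the step and
  -- `1 / (1 - δ')` before it.
  have main : (x * (push (1 - p) s / (push (1 - p) t - push (1 - p) s))
      + y * (push p s / (push p t - push p s))
        ≤ (1 - (1 - shrink p e) * (p - 1 / 2)) * (s / (t - s))) →
      x * potential δ δ' (p - 1 / 2) (push (1 - p) s) (push (1 - p) t)
      + y * potential δ δ' (p - 1 / 2) (push p s) (push p t)
      ≤ K * (1 - (1 - shrink p e) * (p - 1 / 2)) / (1 - δ')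
        * potential δ δ' (p - 1 / 2) s t := by
    intro h
    have h3 := mul_le_mul_of_nonneg_left h hK0
    have h4 : 0 ≤ K * (1 - (1 - shrink p e) * (p - 1 / 2)) / (1 - δ') := by
      apply div_nonneg (mul_nonneg hK0 _) (by linarith)
      linarith
    calc _ ≤ K * ((1 - (1 - shrink p e) * (p - 1 / 2)) * (s / (t - s))) := by linarith
      _ = K * (1 - (1 - shrink p e) * (p - 1 / 2)) / (1 - δ') * (s / (t - s) * (1 - δ')) := by
        have : 1 - δ' ≠ 0 := by linarith
        field_simp
      _ ≤ _ := mul_le_mul_of_nonneg_left hφ h4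
  rcases le_or_gt (1 / 2) s with hs2 | hs2
  · refine (main ?_).trans (mul_le_mul_of_nonneg_right (le_max_left _ _) hφ0)
    refine (ratio_contract_tail hp he hpe hs2 hst ht1 hye hxy).trans ?_
    apply mul_le_mul_of_nonneg_right _ hR
    linarith
  have hrc := ratio_contract_target hp he hpe hs hs2 ht hye hxy
  by_cases hflag : (p - 1 / 2) * (t - s) ≤ t - 1 / 2
  · refine (main (hrc.trans ?_)).trans (mul_le_mul_of_nonneg_right (le_max_left _ _) hφ0)
    apply mul_le_mul_of_nonneg_right _ hR
    have : p - 1 / 2 ≤ (t - 1 / 2) / (t - s) := (le_div_iff₀ hd).2 hflag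
    have := mul_le_mul_of_nonneg_left this (sub_nonneg.2 hsh.le)
    linarith
  -- Here the current state carries no discount. The mean ratio does not grow, and with probability
  -- at least `ε` the next state is discounted while its ratio is no smaller than the present one.
  · refine le_trans ?_ (mul_le_mul_of_nonneg_right (le_max_right _ _) hφ0)
    have hφ1 : s / (t - s) ≤ potential δ δ' (p - 1 / 2) s t := by
      rw [potential, if_neg hflag, sub_zero]
      apply le_mul_of_one_le_right hR
      have h1 : 1 ≤ 1 / t := (one_le_div (by linarith)).2 ht1
      have := mul_nonneg hδ (sub_nonneg.2 h1)
      linarith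
    have hpt : push p t = p + 2 * (1 - p) * (t - 1 / 2) := push_of_ge ht.le
    have hps : push p s = 2 * p * s := push_of_le hs2.le
    have hlt := push_lt_push h1 (by linarith) hst
    have hps0 := push_nonneg h1 (by linarith) hs
    have hpt1 := push_le_one h1 (by linarith) ht1
    have hdn := potential_push_down_le hp (by linarith) hδ hs hst ht.le ht1 (δ' := δ')
    have hup : s / (t - s) ≤ push p s / (push p t - push p s) := by
      rw [div_le_div_iff₀ hd (by linarith), hpt, hps]
      have : 0 ≤ s * (t - 1 / 2) * (2 * p - 1) := by
        apply mul_nonneg (mul_nonneg hs (by linarith)) (by linarith)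
      linarith
    have hle1 : (1 - (1 - shrink p e) * ((t - 1 / 2) / (t - s))) * (s / (t - s)) ≤ s / (t - s) := by
      have : 0 ≤ (1 - shrink p e) * ((t - 1 / 2) / (t - s)) :=
        mul_nonneg (by linarith) (div_nonneg (by linarith) hd.le)
      exact mul_le_of_le_one_left hR (by linarith)
    have hsum := mul_le_mul_of_nonneg_left (hrc.trans hle1) hK0
    have h6 := mul_le_mul_of_nonneg_left hdn hy
    have h7 := mul_le_mul_of_nonneg_left k1 hx
    have h8 : ε * (s / (t - s)) ≤ y * (push p s / (push p t - push p s)) :=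
      (mul_le_mul_of_nonneg_right hyε hR).trans (mul_le_mul_of_nonneg_left hup hy)
    have h9 := mul_le_mul_of_nonneg_left h8 hδ'
    have h10 : x * potential δ δ' (p - 1 / 2) (push (1 - p) s) (push (1 - p) t)
      + y * potential δ δ' (p - 1 / 2) (push p s) (push p t) ≤ (K - δ' * ε) * (s / (t - s)) := by
      linarith
    rcases le_or_gt 0 (K - δ' * ε) with hn | hn
    · exact h10.trans (mul_le_mul_of_nonneg_left hφ1 hn)
    · have := mul_le_mul_of_nonneg_left (by linarith : ε ≤ 1) hδ'
      linarith

/-- The one-step contraction of the potential. -/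
theorem exists_potential_contract {p e ε : ℝ} (hp : 1 / 2 < p) (he : 0 < e)
    (hpe : p < 1 - e) (hε : 0 < ε) :
    ∃ δ δ' c ν : ℝ, 0 ≤ δ ∧ δ ≤ 1 ∧ 0 ≤ δ' ∧ δ' ≤ 1 / 2 ∧ 0 < ν ∧ ν < 1 ∧
      ∀ s t x y : ℝ, 0 ≤ s → s < t → t ≤ 1 → 0 ≤ x → 0 ≤ y → x + y ≤ 1 →
        (1 / 2 < t → y ≤ e ∧ ε ≤ y) → (t = 1 / 2 → x ≤ e ∧ y ≤ e) → (t < 1 / 2 → x ≤ e) →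
        x * potential δ δ' c (push (1 - p) s) (push (1 - p) t)
          + y * potential δ δ' c (push p s) (push p t) ≤ ν ^ 4 * potential δ δ' c s t := by
  have h1 : 0 < p := by linarith
  have h2 : 0 < 1 - p := by linarith
  have hsh := shrink_lt_one hp he.le hpe
  have hsh0 := shrink_nonneg hp he.le hpe
  set w := (1 - shrink p e) * (p - 1 / 2) with hw
  have hw0 : 0 < w := mul_pos (by linarith) (by linarith)
  have hw1 : w < 1 := by nlinarith
  set κ := p / (1 - p) with hκ
  have hκ0 : 0 < κ := by positivity
  -- With `δ' = w / 2` fixed, all three factors are below `1` at `δ = 0`, so they stay below `1` for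
  -- small positive `δ`. Positivity of `δ` is needed only on the far side.
  obtain ⟨δ, hδ0, hδ1, ha, hb, hc⟩ : ∃ δ : ℝ, 0 < δ ∧ δ ≤ 1 ∧ 2 * e * (1 + δ * κ) < 1 ∧
      (1 + δ * κ) * (1 - w) / (1 - w / 2) < 1 ∧ 1 + δ * κ - w / 2 * ε < 1 := by
    have T : ∀ F : ℝ → ℝ, Continuous F → F 0 < 1 →
        ∀ᶠ δ in nhdsWithin (0 : ℝ) (Ioi 0), F δ < 1 := fun F hF h0 =>
      (nhdsWithin_le_nhds : nhdsWithin (0 : ℝ) (Ioi 0) ≤ nhds 0)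
        (hF.continuousAt.eventually_lt_const h0)
    have A := T (fun δ => 2 * e * (1 + δ * κ)) (by fun_prop) (by simp; linarith)
    have B := T (fun δ => (1 + δ * κ) * (1 - w) / (1 - w / 2)) (by fun_prop) (by
      simp only [zero_mul, add_zero, one_mul]
      rw [div_lt_one (by linarith)]; linarith)
    have C := T (fun δ => 1 + δ * κ - w / 2 * ε) (by fun_prop) (by
      simp only [zero_mul, add_zero]
      have : 0 < w / 2 * ε := by positivity
      linarith)
    have D : ∀ᶠ δ in nhdsWithin (0 : ℝ) (Ioi 0), δ < 1 := T (fun δ => δ) continuous_id (by norm_num)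
    obtain ⟨δ, ⟨⟨⟨⟨h1, h2⟩, h3⟩, h4⟩, h5⟩⟩ :=
      ((((A.and B).and C).and D).and self_mem_nhdsWithin).exists
    exact ⟨δ, h5, h4.le, h1, h2, h3⟩
  set lam := max (max (1 - δ * ((1 - shrink p e) / 2)) (2 * e * (1 + δ * κ)))
    (max ((1 + δ * κ) * (1 - w) / (1 - w / 2)) (1 + δ * κ - w / 2 * ε)) with hlam
  have hl1 : lam < 1 := by
    refine max_lt (max_lt ?_ ha) (max_lt hb hc)
    have : 0 < δ * ((1 - shrink p e) / 2) := mul_pos hδ0 (by linarith)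
    linarith
  have hl0 : 0 < lam :=
    lt_of_lt_of_le (by positivity : 0 < 2 * e * (1 + δ * κ))
      ((le_max_right _ _).trans (le_max_left _ _))
  -- The rate is written as a fourth power because `exists_settleTime_le` takes a fourth root of the
  -- tail bounds.
  have hν : (lam ^ (1 / 4 : ℝ)) ^ 4 = lam := by
    rw [← Real.rpow_natCast, ← Real.rpow_mul hl0.le]; norm_num
  refine ⟨δ, w / 2, p - 1 / 2, lam ^ (1 / 4 : ℝ), hδ0.le, hδ1, by linarith, by linarith,
    Real.rpow_pos_of_pos hl0 _, Real.rpow_lt_one hl0.le hl1 (by norm_num), ?_⟩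
  intro s t x y hs hst ht hx hy hxy H1 H2 H3
  rw [hν]
  have hφ0 : 0 ≤ potential δ (w / 2) (p - 1 / 2) s t :=
    (mul_nonneg (div_nonneg hs (by linarith)) (by linarith)).trans
      (le_potential hs hst ht hδ0.le (by linarith : 0 ≤ w / 2))
  rcases lt_trichotomy t (1 / 2) with h | h | h
  · refine (potential_contract_far hp he.le hpe hδ0.le hδ1 (by linarith) (by linarith) hs hst h hx hy
      hxy (H3 h)).trans (mul_le_mul_of_nonneg_right ?_ hφ0)
    exact (le_max_left _ _).trans (le_max_left _ _)
  · refine (potential_contract_at hp he.le hpe hδ0.le (by linarith) (by linarith) hs hst h hx hy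
      (H2 h).1 (H2 h).2).trans (mul_le_mul_of_nonneg_right ?_ hφ0)
    exact (le_max_right _ _).trans (le_max_left _ _)
  · refine (potential_contract_near hp he.le hpe hδ0.le (by linarith) hs hst h ht hx hy hxy
      (H1 h).1 (H1 h).2 (by linarith)).trans (mul_le_mul_of_nonneg_right ?_ hφ0)
    exact le_max_right _ _


/-! ### Binary histories -/

/-- Adding an entry to a list. -/
def consEmbedding : Bool × List Bool ↪ List Bool :=
  ⟨fun q => q.1 :: q.2, fun a b h => by injection h with h1 h2; exact Prod.ext h1 h2⟩

@[simp] lemma consEmbedding_apply (b : Bool) (t : List Bool) : consEmbedding (b, t) = b :: t := rfl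

/-- The lists of length `n` with entries in `Bool`; the head is the last entry in time. -/
def paths : ℕ → Finset (List Bool)
  | 0 => {[]}
  | n + 1 => (Finset.univ ×ˢ paths n).map consEmbedding

lemma mem_paths {n : ℕ} {h : List Bool} : h ∈ paths n ↔ h.length = n := by
  induction n generalizing h with
  | zero => simp [paths, List.length_eq_zero_iff]
  | succ n ih =>
    cases h with
    | nil => simp [paths]
    | cons b t => cases b <;> simp [paths, ih]

lemma sum_paths_succ {M : Type*} [AddCommMonoid M] (n : ℕ) (f : List Bool → M) :
    ∑ h ∈ paths (n + 1), f h = ∑ h ∈ paths n, (f (true :: h) + f (false :: h)) := by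
  rw [paths, Finset.sum_map, Finset.sum_product_right]
  simp

lemma sum_paths_map_not {M : Type*} [AddCommMonoid M] (n : ℕ) (f : List Bool → M) :
    ∑ h ∈ paths n, f (h.map not) = ∑ h ∈ paths n, f h := by
  induction n generalizing f with
  | zero => simp [paths]
  | succ n ih =>
    rw [sum_paths_succ, sum_paths_succ, ← ih fun h => f (true :: h) + f (false :: h)]
    refine Finset.sum_congr rfl fun h _ => ?_
    simp only [List.map_cons, Bool.not_true, Bool.not_false]
    rw [add_comm]

/-- The sum of a path of `1` and `-1`. -/
def score (h : List Bool) : ℝ := h.count true - h.count false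

lemma score_cons_true (h : List Bool) : score (true :: h) = score h + 1 := by
  simp [score]; ring

lemma score_cons_false (h : List Bool) : score (false :: h) = score h - 1 := by
  simp [score]; ring

lemma count_map_not (h : List Bool) (b : Bool) : (h.map not).count b = h.count (!b) := by
  induction h with
  | nil => simp
  | cons a t ih => cases a <;> cases b <;> simp_all

lemma score_map_not (h : List Bool) : score (h.map not) = -score h := by
  simp [score, count_map_not]

lemma length_eq_count_add (h : List Bool) : h.length = h.count true + h.count false := by
  induction h with
  | nil => simp
  | cons a t ih => cases a <;> simp <;> omega

/-- The path has not reached the boundary. -/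
def Alive (η : ℝ) : List Bool → Prop
  | [] => True
  | b :: t => Alive η t ∧ ¬ boundary η (t.length + 1) ≤ |score (b :: t)|

/-- The path reaches the boundary at its last step. -/
def Stops (η : ℝ) : List Bool → Prop
  | [] => False
  | b :: t => Alive η t ∧ boundary η (t.length + 1) ≤ |score (b :: t)|

lemma alive_map_not (η : ℝ) (h : List Bool) : Alive η (h.map not) ↔ Alive η h := by
  induction h with
  | nil => simp [Alive]
  | cons b t ih =>
    have := score_map_not (b :: t)
    rw [List.map_cons] at this ⊢
    rw [Alive, Alive, ih, this, abs_neg, List.length_map]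

lemma stops_map_not (η : ℝ) (h : List Bool) : Stops η (h.map not) ↔ Stops η h := by
  cases h with
  | nil => simp [Stops]
  | cons b t =>
    have := score_map_not (b :: t)
    rw [List.map_cons] at this ⊢
    rw [Stops, Stops, alive_map_not, this, abs_neg, List.length_map]

/-- The probability of a path under a uniformly distributed success probability. -/
noncomputable def leibnizWeight (h : List Bool) : ℝ :=
  ((h.count true).factorial * (h.count false).factorial : ℝ) / (h.length + 1).factorial

lemma leibnizWeight_nonneg (h : List Bool) : 0 ≤ leibnizWeight h := by
  rw [leibnizWeight]; positivity

lemma leibnizWeight_map_not (h : List Bool) : leibnizWeight (h.map not) = leibnizWeight h := by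
  simp [leibnizWeight, count_map_not, mul_comm]

/-- Laplace's rule of succession: the next toss is `true` with probability `(u + 1) / (u + v + 2)`
after `u` successes and `v` failures. -/
lemma leibnizWeight_cons_add (h : List Bool) :
    leibnizWeight (true :: h) + leibnizWeight (false :: h) = leibnizWeight h := by
  have hl := length_eq_count_add h
  simp only [leibnizWeight, List.count_cons, List.length_cons, beq_iff_eq, if_true,
    Bool.false_eq_true, if_false, add_zero, reduceCtorEq, hl]
  set u := h.count true
  set v := h.count false
  have h1 : ((u + v + 1 + 1).factorial : ℝ) = (u + v + 2) * (u + v + 1).factorial := by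
    rw [Nat.factorial_succ (u + v + 1)]; push_cast; ring
  have h2 : ((u + v + 1).factorial : ℝ) ≠ 0 := by positivity
  have h3 : (u + v + 2 : ℝ) ≠ 0 := by positivity
  rw [h1, Nat.factorial_succ u, Nat.factorial_succ v]
  push_cast
  field_simp
  ring

open Classical in
/-- Kraft's equality for the paths stopped at the boundary. -/
lemma kraft (η : ℝ) (n : ℕ) :
    (∑ m ∈ Finset.range (n + 1), ∑ h ∈ paths m, if Stops η h then leibnizWeight h else 0)
      + ∑ h ∈ paths n, (if Alive η h then leibnizWeight h else 0) = 1 := by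
  induction n with
  | zero => simp [paths, Stops, Alive, leibnizWeight]
  | succ n ih =>
    rw [Finset.sum_range_succ, add_assoc, ← ih, ← Finset.sum_add_distrib]
    congr 1
    rw [sum_paths_succ]
    refine Finset.sum_congr rfl fun h _ => ?_
    have := leibnizWeight_cons_add h
    simp only [Stops, Alive]
    by_cases hA : Alive η h <;> by_cases h1 : boundary η (h.length + 1) ≤ |score (true :: h)| <;>
      by_cases h2 : boundary η (h.length + 1) ≤ |score (false :: h)| <;> simp [hA, h1, h2, this]

-- Negating all tosses preserves stopping and weight and reverses the score, so each sign receives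
-- at most half of the total mass in `kraft`. This is the source of `η / 2` in place of `η`.
open Classical in
lemma sum_stops_neg_le (η : ℝ) (n : ℕ) :
    (∑ m ∈ Finset.range n, ∑ h ∈ paths m,
      if Stops η h ∧ score h < 0 then leibnizWeight h else 0) ≤ 1 / 2 := by
  have e : ∀ m, (∑ h ∈ paths m, if Stops η h ∧ 0 < score h then leibnizWeight h else 0)
      = ∑ h ∈ paths m, if Stops η h ∧ score h < 0 then leibnizWeight h else 0 := by
    intro m
    rw [← sum_paths_map_not]
    simp [stops_map_not, score_map_not, leibnizWeight_map_not]
  have h1 : (∑ m ∈ Finset.range n, ∑ h ∈ paths m,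
        if Stops η h ∧ score h < 0 then leibnizWeight h else 0)
      + (∑ m ∈ Finset.range n, ∑ h ∈ paths m,
        if Stops η h ∧ 0 < score h then leibnizWeight h else 0)
      ≤ ∑ m ∈ Finset.range (n + 1), ∑ h ∈ paths m, if Stops η h then leibnizWeight h else 0 := by
    rw [← Finset.sum_add_distrib]
    refine (Finset.sum_le_sum fun m _ => ?_).trans
      (Finset.sum_le_sum_of_subset_of_nonneg (Finset.range_mono n.le_succ) fun m _ _ =>
        Finset.sum_nonneg fun h _ => ?_)
    · rw [← Finset.sum_add_distrib]
      refine Finset.sum_le_sum fun h _ => ?_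
      have := leibnizWeight_nonneg h
      rcases lt_trichotomy (score h) 0 with h0 | h0 | h0
      · simp [h0, not_lt.2 h0.le]
      · simp only [h0, lt_self_iff_false, and_false, if_false, add_zero]
        split_ifs <;> simp [this]
      · simp [h0, not_lt.2 h0.le]
    · have := leibnizWeight_nonneg h
      split_ifs <;> simp [this]
  have h2 : 0 ≤ ∑ h ∈ paths n, (if Alive η h then leibnizWeight h else 0) :=
    Finset.sum_nonneg fun h _ => by
      have := leibnizWeight_nonneg h
      split_ifs <;> simp [this]
  have h3 := kraft η n
  simp only [e] at h1
  linarith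

/-- Chernoff's bound: one term of the binomial expansion of `(exp x + exp (-x)) ^ (u + v)`, together
with `cosh x ≤ exp (x ^ 2 / 2)`. -/
lemma choose_mul_exp_le (u v : ℕ) (x : ℝ) :
    ((u + v).choose u : ℝ) * Real.exp (x * (u - v)) ≤ 2 ^ (u + v) * Real.exp ((u + v) * (x ^ 2 / 2)) := by
  have h1 : (Real.exp x + Real.exp (-x)) ^ (u + v) = 2 ^ (u + v) * Real.cosh x ^ (u + v) := by
    rw [← mul_pow, Real.cosh_eq]; congr 1; ring
  have h2 : ((u + v).choose u : ℝ) * Real.exp (x * (u - v)) ≤ (Real.exp x + Real.exp (-x)) ^ (u + v) := by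
    rw [add_pow]
    refine le_trans (le_of_eq ?_) (Finset.single_le_sum
      (f := fun m => Real.exp x ^ m * Real.exp (-x) ^ (u + v - m) * ((u + v).choose m : ℝ))
      (fun _ _ => by positivity) (Finset.mem_range.2 (by omega : u < u + v + 1)))
    simp only [Nat.add_sub_cancel_left]
    rw [← Real.exp_nat_mul, ← Real.exp_nat_mul, ← Real.exp_add, mul_comm]
    congr 2; ring
  rw [h1] at h2
  refine h2.trans (mul_le_mul_of_nonneg_left ?_ (by positivity))
  calc Real.cosh x ^ (u + v) ≤ Real.exp (x ^ 2 / 2) ^ (u + v) :=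
        pow_le_pow_left₀ (Real.cosh_pos x).le (Real.cosh_le_exp_half_sq x) _
    _ = _ := by rw [← Real.exp_nat_mul]; push_cast; rfl

/-- The boundary is made for this: for a path of length `n` with score `d`, it says that `exp (d ^ 2
/ (2 * n)) ≥ (n + 1) / η`, while the weight of the path is `1 / ((n + 1) * n.choose u)`, where `u`
counts its successes. -/
lemma half_pow_le_of_stops {η : ℝ} (hη : 0 < η) (hη1 : η < 1) {h : List Bool} (hs : Stops η h) :
    (1 / 2 : ℝ) ^ h.length ≤ η * leibnizWeight h := by
  cases h with
  | nil => exact absurd hs id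
  | cons b t =>
    obtain ⟨-, hb⟩ := hs
    have hl := length_eq_count_add (b :: t)
    have hpos : 1 ≤ (b :: t).length := by simp
    rw [← List.length_cons (a := b)] at hb
    generalize b :: t = h at *
    have hs : score h = h.count true - h.count false := rfl
    rw [hs, boundary, hl] at hb
    rw [hl] at hpos
    rw [leibnizWeight, hl]
    clear hs hl
    generalize h.count true = u at *
    generalize h.count false = v at *
    have hm : (0 : ℝ) < ((u + v : ℕ) : ℝ) := by exact_mod_cast hpos
    have hlog : 0 ≤ Real.log ((u + v : ℕ) + 1) - Real.log η := by
      have := Real.log_nonneg (by linarith : (1 : ℝ) ≤ ((u + v : ℕ) : ℝ) + 1)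
      have := Real.log_neg hη hη1
      linarith
    have hsq : 2 * ((u + v : ℕ) : ℝ) * (Real.log ((u + v : ℕ) + 1) - Real.log η) ≤ ((u : ℝ) - v) ^ 2 := by
      rw [← sq_abs ((u : ℝ) - v)]
      calc _ = _ := (Real.sq_sqrt (by positivity)).symm
        _ ≤ _ := pow_le_pow_left₀ (Real.sqrt_nonneg _) hb 2
    -- The optimal exponent in Chernoff's bound is score over length.
    have hc := choose_mul_exp_le u v (((u : ℝ) - v) / (u + v : ℕ))
    have hm' : ((u + v : ℕ) : ℝ) = u + v := by push_cast; ring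
    rw [hm'] at hm hb hlog hsq hc
    set d : ℝ := u - v
    set M : ℝ := u + v
    have e1 : d / M * d = d ^ 2 / (2 * M) + d ^ 2 / (2 * M) := by field_simp; ring
    have e2 : M * ((d / M) ^ 2 / 2) = d ^ 2 / (2 * M) := by field_simp
    rw [e1, e2, Real.exp_add, ← mul_assoc] at hc
    have hc' : ((u + v).choose u : ℝ) * Real.exp (d ^ 2 / (2 * M)) ≤ 2 ^ (u + v) :=
      le_of_mul_le_mul_right hc (Real.exp_pos _)
    have he : (M + 1) / η ≤ Real.exp (d ^ 2 / (2 * M)) := by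
      rw [← Real.exp_log (by positivity : 0 < (M + 1) / η), Real.log_div (by positivity) hη.ne']
      apply Real.exp_le_exp.2
      rw [le_div_iff₀ (by positivity)]
      linarith
    have hch : ((u + v).choose u : ℝ) * (u.factorial * v.factorial) = (u + v).factorial := by
      rw [← mul_assoc, Nat.choose_symm_add]; exact_mod_cast Nat.add_choose_mul_factorial_mul_factorial u v
    have hf : ((u + v + 1).factorial : ℝ) = (M + 1) * (u + v).factorial := by
      rw [Nat.factorial_succ]; push_cast; rfl
    rw [hf, ← hch]
    have hu : (0 : ℝ) < u.factorial * v.factorial := by positivity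
    have hcp : (0 : ℝ) < (u + v).choose u := by
      exact_mod_cast Nat.choose_pos (Nat.le_add_right u v)
    have h3 : ((u + v).choose u : ℝ) * ((M + 1) / η) ≤ 2 ^ (u + v) :=
      (mul_le_mul_of_nonneg_left he hcp.le).trans hc'
    rw [one_div, inv_pow]
    calc ((2 : ℝ) ^ (u + v))⁻¹ ≤ (((u + v).choose u : ℝ) * ((M + 1) / η))⁻¹ :=
          inv_anti₀ (by positivity) h3
      _ = _ := by field_simp

/-! ### The test of power one -/

/-- The path of the first `m` answers. -/
noncomputable def pathOf (z : ℕ → ℝ) : ℕ → List Bool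
  | 0 => []
  | m + 1 => (open Classical in decide (z m = 1)) :: pathOf z m

@[simp] lemma length_pathOf (z : ℕ → ℝ) (m : ℕ) : (pathOf z m).length = m := by
  induction m with
  | zero => rfl
  | succ m ih => simp [pathOf, ih]

lemma score_pathOf {z : ℕ → ℝ} (hz : ∀ i, z i = 1 ∨ z i = -1) (m : ℕ) :
    score (pathOf z m) = walk z m := by
  induction m with
  | zero => simp [pathOf, score, walk]
  | succ m ih =>
    rw [walk, Finset.sum_range_succ, ← walk, ← ih]
    rcases hz m with h | h
    · simp [pathOf, h, score_cons_true]
    · have : ¬ (-1 : ℝ) = 1 := by norm_num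
      simp [pathOf, h, this, score_cons_false]; ring

lemma alive_pathOf {η : ℝ} {z : ℕ → ℝ} (hz : ∀ i, z i = 1 ∨ z i = -1) {m : ℕ}
    (h : ∀ j, 1 ≤ j → j ≤ m → ¬ boundary η j ≤ |walk z j|) : Alive η (pathOf z m) := by
  induction m with
  | zero => trivial
  | succ m ih =>
    refine ⟨ih fun j h1 h2 => h j h1 (by omega), ?_⟩
    have := score_pathOf hz (m + 1)
    rw [pathOf] at this
    rw [this, length_pathOf]
    exact h (m + 1) (by omega) le_rfl

lemma exists_of_verdict_ne_zero {η : ℝ} {z : ℕ → ℝ} (h : verdict η z ≠ 0) :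
    ∃ m, 1 ≤ m ∧ boundary η m ≤ |walk z m| ∧ (∀ j < m, 1 ≤ j → ¬ boundary η j ≤ |walk z j|) ∧
      verdict η z = SignType.sign (walk z m) := by
  classical
  rw [verdict] at h ⊢
  split_ifs at h ⊢ with hex
  · refine ⟨Nat.find hex, (Nat.find_spec hex).1, (Nat.find_spec hex).2, fun j hj h1 h2 => ?_, rfl⟩
    exact Nat.find_min hex hj ⟨h1, h2⟩
  · exact absurd rfl h

lemma verdict_eq {η : ℝ} {z : ℕ → ℝ} {m : ℕ} (h1 : 1 ≤ m) (h2 : boundary η m ≤ |walk z m|)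
    (h3 : ∀ j < m, 1 ≤ j → ¬ boundary η j ≤ |walk z j|) :
    verdict η z = SignType.sign (walk z m) := by
  classical
  have hex : ∃ m : ℕ, 1 ≤ m ∧ boundary η m ≤ |walk z m| := ⟨m, h1, h2⟩
  have : Nat.find hex = m :=
    (Nat.find_eq_iff hex).2 ⟨⟨h1, h2⟩, fun j hj h => h3 j hj h.1 h.2⟩
  rw [verdict, dif_pos hex, this]

lemma boundary_pos {η : ℝ} (hη : 0 < η) (hη1 : η < 1) {m : ℕ} (hm : 1 ≤ m) : 0 < boundary η m := by
  have hm' : (1 : ℝ) ≤ m := by exact_mod_cast hm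
  have := Real.log_nonneg (by linarith : (1 : ℝ) ≤ m + 1)
  have := Real.log_neg hη hη1
  rw [boundary]
  apply Real.sqrt_pos.2
  have : 0 < Real.log (m + 1) - Real.log η := by linarith
  positivity

lemma walk_neg (z : ℕ → ℝ) (m : ℕ) : walk (-z) m = -walk z m := by simp [walk]

lemma verdict_neg (η : ℝ) (z : ℕ → ℝ) : verdict η (-z) = -verdict η z := by
  classical
  simp only [verdict, walk_neg, abs_neg]
  split_ifs
  · rw [Left.sign_neg]
  · simp

lemma measurable_walk (m : ℕ) : Measurable fun z : ℕ → ℝ => walk z m := by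
  unfold walk; fun_prop

lemma measurableSet_verdict_eq (η : ℝ) (s : SignType) (hs : s ≠ 0) :
    MeasurableSet {z : ℕ → ℝ | verdict η z = s} := by
  have : {z : ℕ → ℝ | verdict η z = s} = ⋃ m : ℕ, ⋃ _ : 1 ≤ m,
      ({z | boundary η m ≤ |walk z m|} ∩ (⋂ j : ℕ, ⋂ _ : j < m, ⋂ _ : 1 ≤ j,
        {z | boundary η j ≤ |walk z j|}ᶜ)) ∩ {z | SignType.sign (walk z m) = s} := by
    ext z
    simp only [mem_ofPred_eq, mem_iUnion, mem_inter_iff, mem_iInter, mem_compl_iff, exists_prop]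
    constructor
    · intro h
      obtain ⟨m, h1, h2, h3, h4⟩ := exists_of_verdict_ne_zero (h ▸ hs)
      exact ⟨m, h1, ⟨h2, h3⟩, h4 ▸ h⟩
    · rintro ⟨m, h1, ⟨h2, h3⟩, h4⟩
      rw [verdict_eq h1 h2 h3, h4]
  rw [this]
  have hB : ∀ m : ℕ, MeasurableSet {z : ℕ → ℝ | boundary η m ≤ |walk z m|} := fun m =>
    measurableSet_le measurable_const (measurable_walk m).abs
  have hS : ∀ m : ℕ, MeasurableSet {z : ℕ → ℝ | SignType.sign (walk z m) = s} := by
    intro m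
    rcases s with _ | _ | _
    · exact absurd rfl hs
    · simp only [SignType.neg_eq_neg_one, sign_eq_neg_one_iff]
      exact measurableSet_lt (measurable_walk m) measurable_const
    · simp only [SignType.pos_eq_one, sign_eq_one_iff]
      exact measurableSet_lt measurable_const (measurable_walk m)
  exact .iUnion fun m => .iUnion fun _ => ((hB m).inter (.iInter fun j => .iInter fun _ =>
    .iInter fun _ => (hB j).compl)).inter (hS m)


/-! ### Independence of disjoint blocks of noise. -/

/-- Events depending on disjoint sets of coordinates of an independent family are independent. -/
lemma measure_inter_eq_mul_of_disjoint {Ω ι β : Type*} [MeasurableSpace Ω] {P : Measure Ω}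
    [mβ : MeasurableSpace β] {X : ι → Ω → β} (hX : ∀ i, Measurable (X i)) (hind : iIndepFun X P)
    {S T : Set ι} (hST : Disjoint S T) {E F : Set Ω}
    (hE : MeasurableSet[⨆ i ∈ S, MeasurableSpace.comap (X i) mβ] E)
    (hF : MeasurableSet[⨆ i ∈ T, MeasurableSpace.comap (X i) mβ] F) :
    P (E ∩ F) = P E * P F :=
  (Indep_iff _ _ _).1 (indep_iSup_of_disjoint (fun i => (hX i).comap_le) hind.iIndep hST) E F hE hF

/-- Functions of disjoint blocks of an independent family are independent. -/
lemma iIndepFun_of_disjoint {Ω ι β : Type*} [MeasurableSpace Ω] {P : Measure Ω}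
    [IsProbabilityMeasure P]
    [mβ : MeasurableSpace β] {X : ι → Ω → β} (hX : ∀ i, Measurable (X i)) (hind : iIndepFun X P)
    {κ : Type*} {S : κ → Set ι} (hS : Pairwise fun a b => Disjoint (S a) (S b)) {z : κ → Ω → ℝ}
    (hz : ∀ k, Measurable[⨆ i ∈ S k, MeasurableSpace.comap (X i) mβ] (z k)) :
    iIndepFun z P := by
  classical
  rw [iIndepFun_iff_measure_inter_preimage_eq_mul]
  intro A
  induction A using Finset.induction_on with
  | empty => intro _ _; simp
  | insert a A ha ih =>
    intro sets H
    rw [Finset.set_biInter_insert, Finset.prod_insert ha,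
      ← ih fun i hi => H i (Finset.mem_insert_of_mem hi)]
    refine measure_inter_eq_mul_of_disjoint hX hind (S := S a) (T := ⋃ k ∈ A, S k) ?_ ?_ ?_
    · simp only [disjoint_iUnion_right]
      exact fun k hk => hS (ne_of_mem_of_not_mem hk ha).symm
    · exact hz a (H a (Finset.mem_insert_self _ _))
    · refine @Finset.measurableSet_biInter _ _ (_) _ A fun k hk => ?_
      have hle : (⨆ i ∈ S k, MeasurableSpace.comap (X i) mβ)
          ≤ ⨆ i ∈ ⋃ k ∈ A, S k, MeasurableSpace.comap (X i) mβ :=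
        biSup_mono fun i hi => mem_biUnion hk hi
      exact hle _ (hz k (H k (Finset.mem_insert_of_mem hk)))

/-! ### Error probabilities and termination of the test for a coin of given bias. -/

/-- A sequence of independent tosses, with values in `{1, -1}`, of a coin that shows `1` with
probability `q`. -/
structure IsCoin {Ω : Type*} [MeasurableSpace Ω] (P : Measure Ω) (z : ℕ → Ω → ℝ) (q : ℝ) : Prop where
  measurable : ∀ i, Measurable (z i)
  indep : iIndepFun z P
  ident : ∀ i, IdentDistrib (z i) (z 0) P P
  values : ∀ i ω, z i ω = 1 ∨ z i ω = -1
  prob : ∀ i, P.real {ω | z i ω = 1} = q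

section Coin

variable {Ω : Type*} [MeasurableSpace Ω] {P : Measure Ω} [IsProbabilityMeasure P]
  {z : ℕ → Ω → ℝ} {q : ℝ}

lemma IsCoin.le_one (hz : IsCoin P z q) : q ≤ 1 := by
  rw [← hz.prob 0]; exact measureReal_le_one

lemma IsCoin.prob_neg (hz : IsCoin P z q) (i : ℕ) : P.real {ω | z i ω = -1} = 1 - q := by
  have : {ω | z i ω = -1} = {ω | z i ω = 1}ᶜ := by
    ext ω
    rcases hz.values i ω with h | h <;> simp [h] <;> norm_num
  have hm : MeasurableSet {ω | z i ω = 1} := hz.measurable i (measurableSet_singleton 1)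
  rw [this, probReal_compl_eq_one_sub hm, hz.prob]

lemma IsCoin.neg (hz : IsCoin P z q) : IsCoin P (-z) (1 - q) where
  measurable i := (hz.measurable i).neg
  indep := hz.indep.comp (fun _ x => -x) fun _ => measurable_neg
  ident i := (hz.ident i).comp measurable_neg
  values i ω := by
    rcases hz.values i ω with h | h <;> simp [h]
  prob i := by
    rw [← hz.prob_neg i]
    congr 1; ext ω
    simp [neg_eq_iff_eq_neg]

lemma IsCoin.measureReal_pathOf (hz : IsCoin P z q) (h : List Bool) :
    P.real {ω | pathOf (fun i => z i ω) h.length = h}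
      = q ^ h.count true * (1 - q) ^ h.count false := by
  -- An initial path depends only on the earlier tosses, hence is independent of the next one.
  have key : ∀ h : List Bool, MeasurableSet[⨆ i ∈ Iio h.length, MeasurableSpace.comap (z i) inferInstance]
      {ω | pathOf (fun i => z i ω) h.length = h} := by
    intro h
    induction h with
    | nil => simp [pathOf]
    | cons b t ih =>
      have : {ω | pathOf (fun i => z i ω) (b :: t).length = b :: t}
          = {ω | pathOf (fun i => z i ω) t.length = t} ∩ z t.length ⁻¹' {x | x = 1 ↔ b = true} := by
        ext ω
        cases b <;> simp [pathOf, and_comm]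
      rw [this]
      refine MeasurableSet.inter ?_ ?_
      · have hle : (⨆ i ∈ Iio t.length, MeasurableSpace.comap (z i) inferInstance)
            ≤ ⨆ i ∈ Iio (b :: t).length, MeasurableSpace.comap (z i) inferInstance :=
          biSup_mono fun i hi => lt_trans (mem_Iio.1 hi) (by simp)
        exact hle _ ih
      · have hle : MeasurableSpace.comap (z t.length) inferInstance
            ≤ ⨆ i ∈ Iio (b :: t).length, MeasurableSpace.comap (z i) inferInstance :=
          le_biSup (fun i => MeasurableSpace.comap (z i) inferInstance) (by simp)
        refine hle _ ⟨_, ?_, rfl⟩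
        cases b
        · have : {x : ℝ | x = 1 ↔ false = true} = {1}ᶜ := by ext; simp
          rw [this]
          exact (measurableSet_singleton (1 : ℝ)).compl
        · simp
  induction h with
  | nil => simp [pathOf]
  | cons b t ih =>
    have e : {ω | pathOf (fun i => z i ω) (b :: t).length = b :: t}
        = {ω | pathOf (fun i => z i ω) t.length = t} ∩ {ω | z t.length ω = if b then 1 else -1} := by
      ext ω
      rcases hz.values t.length ω with h | h <;> cases b <;> simp [pathOf, h] <;> norm_num
    have hm : MeasurableSet[⨆ i ∈ ({t.length} : Set ℕ), MeasurableSpace.comap (z i) inferInstance]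
        {ω | z t.length ω = if b then 1 else -1} := by
      rw [iSup_singleton]
      exact ⟨{if b then 1 else -1}, measurableSet_singleton _, rfl⟩
    have := measure_inter_eq_mul_of_disjoint hz.measurable hz.indep (S := Iio t.length)
      (T := {t.length}) (by simp) (key t) hm
    rw [e, Measure.real, this, ENNReal.toReal_mul, ← Measure.real, ← Measure.real, ih]
    cases b
    · simp only [Bool.false_eq_true, if_false, hz.prob_neg]
      simp; ring
    · simp only [if_true, hz.prob]
      simp; ring

/-- A fair or upward biased coin leads to a negative verdict with probability at most `η / 2`. -/
lemma IsCoin.verdict_neg_le (hz : IsCoin P z q) {η : ℝ} (hη : 0 < η) (hη1 : η < 1)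
    (hq : 1 / 2 ≤ q) : P.real {ω | verdict η (fun i => z i ω) = -1} ≤ η / 2 := by
  classical
  have hq1 := hz.le_one
  have hsub : {ω | verdict η (fun i => z i ω) = -1} ⊆ ⋃ m : ℕ, ⋃ h ∈ (paths m).filter
      (fun h => Stops η h ∧ score h < 0), {ω | pathOf (fun i => z i ω) h.length = h} := by
    intro ω hω
    have hω : verdict η (fun i => z i ω) = -1 := hω
    obtain ⟨m, h1, h2, h3, h4⟩ := exists_of_verdict_ne_zero (η := η) (z := fun i => z i ω)
      (by rw [hω]; decide)
    have hv : ∀ i, z i ω = 1 ∨ z i ω = -1 := fun i => hz.values i ω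
    simp only [mem_iUnion]
    refine ⟨m, pathOf (fun i => z i ω) m, ?_, ?_⟩
    · rw [Finset.mem_filter, mem_paths, length_pathOf]
      refine ⟨rfl, ?_, ?_⟩
      · obtain ⟨n, rfl⟩ : ∃ n, m = n + 1 := ⟨m - 1, by omega⟩
        refine ⟨alive_pathOf hv fun j hj1 hj2 => h3 j (by omega) hj1, ?_⟩
        have := score_pathOf hv (n + 1)
        rw [pathOf] at this
        rw [this, length_pathOf]
        exact h2
      · rw [score_pathOf hv, ← sign_eq_neg_one_iff, ← h4, hω]
    · rw [mem_ofPred_eq, length_pathOf]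
  -- A path with negative score has more failures than successes, so a bias `q ≥ 1 / 2` makes it at
  -- most as likely as fair tossing does.
  have hpath : ∀ h : List Bool, Stops η h → score h < 0 →
      P.real {ω | pathOf (fun i => z i ω) h.length = h} ≤ η * leibnizWeight h := by
    intro h hs hneg
    refine le_trans ?_ (half_pow_le_of_stops hη hη1 hs)
    rw [hz.measureReal_pathOf, length_eq_count_add]
    have hlt : h.count true < h.count false := by
      have : (h.count true : ℝ) < h.count false := by rw [score] at hneg; linarith
      exact_mod_cast this
    obtain ⟨k, hk⟩ := Nat.exists_eq_add_of_lt hlt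
    rw [hk]
    generalize h.count true = u
    have e1 : q ^ u * (1 - q) ^ (u + k + 1) = (q * (1 - q)) ^ u * (1 - q) ^ (k + 1) := by
      rw [mul_pow]; ring
    have e2 : (1 / 2 : ℝ) ^ (u + (u + k + 1)) = (1 / 4) ^ u * (1 / 2) ^ (k + 1) := by
      have : (1 / 4 : ℝ) = (1 / 2) * (1 / 2) := by norm_num
      rw [this, mul_pow]; ring
    rw [e1, e2]
    have h0 : 0 ≤ 1 - q := by linarith
    gcongr
    · nlinarith [sq_nonneg (q - 1 / 2)]
    · linarith
  have hD : ∀ m, P (⋃ h ∈ (paths m).filter (fun h => Stops η h ∧ score h < 0),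
      {ω | pathOf (fun i => z i ω) h.length = h})
      ≤ ENNReal.ofReal (η * ∑ h ∈ paths m, if Stops η h ∧ score h < 0 then leibnizWeight h else 0) := by
    intro m
    rw [← Finset.sum_filter, Finset.mul_sum,
      ENNReal.ofReal_sum_of_nonneg fun h _ => mul_nonneg hη.le (leibnizWeight_nonneg h)]
    refine (measure_biUnion_finset_le _ _).trans (Finset.sum_le_sum fun h hh => ?_)
    rw [Finset.mem_filter] at hh
    rw [← ofReal_measureReal]
    exact ENNReal.ofReal_le_ofReal (hpath h hh.2.1 hh.2.2)
  refine ENNReal.toReal_le_of_le_ofReal (by linarith) ((measure_mono hsub).trans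
    ((measure_iUnion_le _).trans ?_))
  refine ENNReal.tsum_le_of_sum_range_le fun n => ?_
  refine (Finset.sum_le_sum fun m _ => hD m).trans ?_
  rw [← ENNReal.ofReal_sum_of_nonneg fun m _ => mul_nonneg hη.le (Finset.sum_nonneg fun h _ => by
    have := leibnizWeight_nonneg h
    split_ifs <;> simp [this]), ← Finset.mul_sum]
  apply ENNReal.ofReal_le_ofReal
  have := mul_le_mul_of_nonneg_left (sum_stops_neg_le η n) hη.le
  linarith

/-- A biased coin leads to a verdict almost surely. -/
lemma IsCoin.ae_verdict_ne_zero (hz : IsCoin P z q) {η : ℝ} (hη : 0 < η) (hη1 : η < 1)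
    (hq : q ≠ 1 / 2) : ∀ᵐ ω ∂P, verdict η (fun i => z i ω) ≠ 0 := by
  classical
  have hval : z 0 = fun ω => 2 * ({ω | z 0 ω = 1}.indicator 1 ω) - 1 := by
    ext ω
    rcases hz.values 0 ω with h | h
    · simp [h]; norm_num
    · have : ¬ (-1 : ℝ) = 1 := by norm_num
      simp [h, this]
  have hms : MeasurableSet {ω | z 0 ω = 1} := hz.measurable 0 (measurableSet_singleton 1)
  have hi1 : Integrable ({ω | z 0 ω = 1}.indicator (1 : Ω → ℝ)) P :=
    (integrable_const (1 : ℝ)).indicator hms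
  have hint : Integrable (z 0) P := by
    rw [hval]; exact (hi1.const_mul 2).sub (integrable_const 1)
  have hmean : P[z 0] = 2 * q - 1 := by
    rw [hval, integral_sub (hi1.const_mul 2) (integrable_const 1), integral_const_mul,
      integral_indicator_one hms, hz.prob]
    simp
  have hsl := strong_law_ae_real z hint (fun i j hij => hz.indep.indepFun hij) hz.ident
  filter_upwards [hsl] with ω hω hv
  rw [hmean] at hω
  -- The boundary grows sublinearly, whereas by the strong law the walk has the nonzero drift `2 * q
  -- - 1`.
  have hlim : Filter.Tendsto (fun n : ℕ => boundary η n / n) Filter.atTop (nhds 0) := by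
    have h1 : Filter.Tendsto (fun n : ℕ => 2 * (Real.log ((n : ℝ) + 1) - Real.log η) / n)
        Filter.atTop (nhds 0) := by
      have ha : Filter.Tendsto (fun x : ℝ => Real.log x / x) Filter.atTop (nhds 0) :=
        (Real.isLittleO_log_id_atTop).tendsto_div_nhds_zero
      have hb : Filter.Tendsto (fun n : ℕ => (n : ℝ) + 1) Filter.atTop Filter.atTop :=
        Filter.tendsto_atTop_add_const_right _ _ tendsto_natCast_atTop_atTop
      have hc : Filter.Tendsto (fun n : ℕ => 1 / (n : ℝ)) Filter.atTop (nhds 0) :=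
        tendsto_one_div_atTop_nhds_zero_nat
      have hd := ha.comp hb
      have he : Filter.Tendsto (fun n : ℕ => 2 * (Real.log ((n : ℝ) + 1) / ((n : ℝ) + 1)
          * (1 + 1 / n)) - 2 * Real.log η * (1 / n)) Filter.atTop (nhds (2 * (0 * (1 + 0)) - 2 * Real.log η * 0)) :=
        ((hd.mul (hc.const_add 1)).const_mul 2).sub (hc.const_mul _)
      simp only [zero_mul, mul_zero, sub_zero] at he
      refine he.congr' ?_
      filter_upwards [Filter.eventually_gt_atTop 0] with n hn
      have : (0 : ℝ) < n := by exact_mod_cast hn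
      field_simp
    have h2 := (Real.continuous_sqrt.tendsto 0).comp h1
    rw [Real.sqrt_zero] at h2
    refine h2.congr' ?_
    filter_upwards [Filter.eventually_gt_atTop 0] with n hn
    have hn' : (0 : ℝ) < n := by exact_mod_cast hn
    have hl : 0 ≤ Real.log ((n : ℝ) + 1) - Real.log η := by
      have := Real.log_nonneg (by linarith : (1 : ℝ) ≤ n + 1)
      have := Real.log_neg hη hη1
      linarith
    simp only [Function.comp, boundary]
    calc Real.sqrt (2 * (Real.log ((n : ℝ) + 1) - Real.log η) / n)
        = Real.sqrt (2 * n * (Real.log (n + 1) - Real.log η) / (n : ℝ) ^ 2) := by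
          congr 1; field_simp
      _ = _ := by rw [Real.sqrt_div (mul_nonneg (by positivity) hl), Real.sqrt_sq hn'.le]
  have habs := hω.abs
  have hpos : 0 < |2 * q - 1| := abs_pos.2 fun h => hq (by linarith)
  obtain ⟨n, hn, hn1⟩ := ((hlim.eventually_lt habs hpos).and (Filter.eventually_ge_atTop 1)).exists
  have hn' : (0 : ℝ) < n := by exact_mod_cast hn1
  rw [abs_div, abs_of_pos hn', div_lt_div_iff_of_pos_right hn'] at hn
  have hex : ∃ m : ℕ, 1 ≤ m ∧ boundary η m ≤ |walk (fun i => z i ω) m| := ⟨n, hn1, hn.le⟩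
  rw [verdict, dif_pos hex, sign_eq_zero_iff] at hv
  have := (Nat.find_spec hex).2
  rw [hv, abs_zero] at this
  exact absurd (boundary_pos hη hη1 (Nat.find_spec hex).1) (not_lt.2 this)

lemma exists_boundary_le {η : ℝ} (hη : 0 < η) (hη1 : η < 1) : ∃ m : ℕ, 1 ≤ m ∧ boundary η m ≤ m := by
  have ha : Filter.Tendsto (fun n : ℕ => Real.log ((n : ℝ) + 1) / ((n : ℝ) + 1)) Filter.atTop (nhds 0) :=
    ((Real.isLittleO_log_id_atTop).tendsto_div_nhds_zero).comp
      (Filter.tendsto_atTop_add_const_right _ _ tendsto_natCast_atTop_atTop)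
  -- The thresholds `1 / 8` and `-4 * log η` make each of `log (n + 1)` and `-log η` at most `n /
  -- 4`, so the square of the boundary is at most `n ^ 2`.
  have hb := ha.eventually_lt_const (by norm_num : (0 : ℝ) < 1 / 8)
  obtain ⟨n, ⟨hn, h1⟩, h2⟩ := ((hb.and (Filter.eventually_ge_atTop 1)).and
    (Filter.eventually_ge_atTop ⌈-4 * Real.log η⌉₊)).exists
  have h1' : (1 : ℝ) ≤ n := by exact_mod_cast h1
  have h2' : -4 * Real.log η ≤ n := Nat.ceil_le.1 h2
  refine ⟨n, h1, ?_⟩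
  rw [boundary]
  apply Real.sqrt_le_iff.2 ⟨by linarith, ?_⟩
  rw [div_lt_iff₀ (by linarith)] at hn
  nlinarith

/-- The probability of the verdict `-1` is bounded below in terms of the bias of the coin. -/
lemma IsCoin.le_verdict_neg (hz : IsCoin P z q) {η : ℝ} {m : ℕ}
    (hm : 1 ≤ m) (hb : boundary η m ≤ m) :
    (1 - q) ^ m ≤ P.real {ω | verdict η (fun i => z i ω) = -1} := by
  classical
  have h0 := hz.measureReal_pathOf (List.replicate m false)
  simp only [List.length_replicate, List.count_replicate, beq_iff_eq, Bool.false_eq_true, if_false,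
    pow_zero, one_mul, beq_self_eq_true, if_true] at h0
  rw [← h0]
  refine measureReal_mono fun ω hω => ?_
  have hω : pathOf (fun i => z i ω) m = List.replicate m false := hω
  have hneg : ∀ n ≤ m, pathOf (fun i => z i ω) n = List.replicate n false := by
    intro n hn
    induction hn using Nat.decreasingInduction with
    | self => exact hω
    | of_succ k hk ih =>
      rw [pathOf, List.replicate_succ] at ih
      exact (List.cons.inj ih).2
  have hwalk : ∀ n ≤ m, walk (fun i => z i ω) n = -n := by
    intro n hn
    rw [← score_pathOf (fun i => hz.values i ω), hneg n hn, score]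
    simp [List.count_replicate]
  have hex : ∃ m : ℕ, 1 ≤ m ∧ boundary η m ≤ |walk (fun i => z i ω) m| :=
    ⟨m, hm, by rw [hwalk m le_rfl]; simpa using hb⟩
  -- The boundary may be crossed before `m`, but along this path the walk is negative at every
  -- earlier positive time too.
  have hle : Nat.find hex ≤ m := Nat.find_min' hex ⟨hm, by rw [hwalk m le_rfl]; simpa using hb⟩
  show verdict η (fun i => z i ω) = -1
  rw [verdict, dif_pos hex, hwalk _ hle, sign_eq_neg_one_iff]
  have := (Nat.find_spec hex).1
  simp only [Left.neg_neg_iff, Nat.cast_pos]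
  omega

lemma IsCoin.verdict_pos_le (hz : IsCoin P z q) {η : ℝ} (hη : 0 < η) (hη1 : η < 1)
    (hq : q ≤ 1 / 2) : P.real {ω | verdict η (fun i => z i ω) = 1} ≤ η / 2 := by
  have := hz.neg.verdict_neg_le hη hη1 (by linarith)
  have e : ∀ ω, verdict η (fun i => (-z) i ω) = -verdict η (fun i => z i ω) := fun ω =>
    verdict_neg η (fun i => z i ω)
  simpa only [e, neg_inj] using this

lemma IsCoin.le_verdict_pos (hz : IsCoin P z q) {η : ℝ} {m : ℕ}
    (hm : 1 ≤ m) (hb : boundary η m ≤ m) :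
    q ^ m ≤ P.real {ω | verdict η (fun i => z i ω) = 1} := by
  have := hz.neg.le_verdict_neg hm hb
  have e : ∀ ω, verdict η (fun i => (-z) i ω) = -verdict η (fun i => z i ω) := fun ω =>
    verdict_neg η (fun i => z i ω)
  simpa only [e, neg_inj, sub_sub_cancel] using this

end Coin


/-! ### Gumbel noise -/

lemma IsGumbel.measureReal_Iic {Ω : Type*} [MeasurableSpace Ω] {P : Measure Ω} {γ : ℝ} {X : Ω → ℝ}
    (hX : IsGumbel P γ X) (a : ℝ) : P.real {ω | X ω ≤ a} = Real.exp (-Real.exp (-a / γ)) := by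
  rw [Measure.real, hX a, ENNReal.toReal_ofReal (Real.exp_pos _).le]

section Gumbel

variable {Ω : Type*} [MeasurableSpace Ω] {P : Measure Ω} [IsProbabilityMeasure P] {γ : ℝ}
  {X Y : Ω → ℝ}

lemma IsGumbel.identDistrib {Ω' : Type*} [MeasurableSpace Ω'] {P' : Measure Ω'}
    [IsProbabilityMeasure P'] {Y : Ω' → ℝ} (hX : IsGumbel P γ X) (hY : IsGumbel P' γ Y)
    (mX : Measurable X) (mY : Measurable Y) : IdentDistrib X Y P P' where
  aemeasurable_fst := mX.aemeasurable
  aemeasurable_snd := mY.aemeasurable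
  map_eq := by
    have := Measure.isProbabilityMeasure_map (μ := P) mX.aemeasurable
    have := Measure.isProbabilityMeasure_map (μ := P') mY.aemeasurable
    refine Measure.ext_of_Iic _ _ fun a => ?_
    rw [Measure.map_apply mX measurableSet_Iic, Measure.map_apply mY measurableSet_Iic]
    exact (hX a).trans (hY a).symm

lemma IsGumbel.measureReal_Ioc (hX : IsGumbel P γ X) (mX : Measurable X) {a b : ℝ} (hab : a ≤ b) :
    P.real {ω | a < X ω ∧ X ω ≤ b}
      = Real.exp (-Real.exp (-b / γ)) - Real.exp (-Real.exp (-a / γ)) := by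
  have hm : MeasurableSet {ω | X ω ≤ a} := measurableSet_le mX measurable_const
  rw [← hX.measureReal_Iic, ← hX.measureReal_Iic, ← measureReal_sdiff _ hm]
  · congr 1; ext ω; simp [and_comm]
  · exact fun ω (hω : X ω ≤ a) => hω.trans hab

lemma exp_neg_exp_lt {γ a b : ℝ} (hγ : 0 < γ) (hab : a < b) :
    Real.exp (-Real.exp (-a / γ)) < Real.exp (-Real.exp (-b / γ)) := by
  apply Real.exp_lt_exp.2
  apply neg_lt_neg
  apply Real.exp_lt_exp.2
  exact div_lt_div_of_pos_right (by linarith) hγ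

lemma IsGumbel.measure_eq (hX : IsGumbel P γ X) (mX : Measurable X) (a : ℝ) :
    P {ω | X ω = a} = 0 := by
  have hc : Continuous fun b : ℝ =>
      Real.exp (-Real.exp (-a / γ)) - Real.exp (-Real.exp (-b / γ)) := by fun_prop
  have ht : Filter.Tendsto (fun b : ℝ =>
      Real.exp (-Real.exp (-a / γ)) - Real.exp (-Real.exp (-b / γ)))
      (nhdsWithin a (Iio a)) (nhds 0) := by
    have := (hc.tendsto a).mono_left (nhdsWithin_le_nhds (s := Iio a))
    rwa [sub_self] at this
  have hle : P.real {ω | X ω = a} ≤ 0 := by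
    refine ge_of_tendsto ht ?_
    filter_upwards [self_mem_nhdsWithin] with b hb
    rw [← hX.measureReal_Ioc mX (le_of_lt hb)]
    refine measureReal_mono fun ω (hω : X ω = a) => ⟨?_, hω.le⟩
    rw [hω]; exact hb
  exact (measureReal_eq_zero_iff).1 (le_antisymm hle measureReal_nonneg)

/-- By Fubini, a tie requires one variable to hit a prescribed point, and the Gumbel law has no
atoms. -/
lemma measure_eq_zero_of_indep (hX : IsGumbel P γ X) (mX : Measurable X)
    (mY : Measurable Y) (hind : IndepFun X Y P) : P {ω | X ω = Y ω} = 0 := by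
  have := Measure.isProbabilityMeasure_map (μ := P) mX.aemeasurable
  have := Measure.isProbabilityMeasure_map (μ := P) mY.aemeasurable
  have hm : MeasurableSet {z : ℝ × ℝ | z.1 = z.2} := measurableSet_eq_fun measurable_fst measurable_snd
  have h1 := Measure.map_apply (μ := P) (mX.prodMk mY) hm
  rw [(indepFun_iff_map_prod_eq_prod_map_map mX.aemeasurable mY.aemeasurable).1 hind,
    Measure.prod_apply_symm hm] at h1
  change _ = P {ω | X ω = Y ω} at h1
  rw [← h1, lintegral_eq_zero_iff (measurable_measure_prodMk_right hm)]
  refine Filter.Eventually.of_forall fun y => ?_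
  have : (fun x => (x, y)) ⁻¹' {z : ℝ × ℝ | z.1 = z.2} = {y} := by ext; simp
  show (P.map X) _ = 0
  rw [this, Measure.map_apply mX (measurableSet_singleton y)]
  exact hX.measure_eq mX y

/-- The probability that the option with the noise `Y` is chosen, when its utility exceeds the other
one by `D`. -/
noncomputable def choiceProb (P : Measure Ω) (X Y : Ω → ℝ) (D : ℝ) : ℝ :=
  P.real {ω | X ω - Y ω < D}

variable (hX : IsGumbel P γ X) (hY : IsGumbel P γ Y) (mX : Measurable X) (mY : Measurable Y)
  (hind : IndepFun X Y P)

include hX hY mX mY hind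

/-- The independent, identically distributed noises are exchangeable; this gives the value `1 / 2`
at zero and the reflection in `choiceProb_le_one_sub`. -/
lemma choiceProb_symm (D : ℝ) : choiceProb P X Y D = P.real {ω | Y ω - X ω < D} := by
  have h := (hX.identDistrib hY mX mY).prodMk (hY.identDistrib hX mY mX) hind hind.symm
  have hm : MeasurableSet {z : ℝ × ℝ | z.1 - z.2 < D} :=
    measurableSet_lt (measurable_fst.sub measurable_snd) measurable_const
  exact congrArg ENNReal.toReal (h.measure_mem_eq hm)

lemma choiceProb_zero : choiceProb P X Y 0 = 1 / 2 := by
  have h1 := choiceProb_symm hX hY mX mY hind 0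
  have h2 : P.real {ω | X ω = Y ω} = 0 := by
    rw [Measure.real, measure_eq_zero_of_indep hX mX mY hind]; rfl
  have m1 : MeasurableSet {ω | X ω - Y ω < 0} := measurableSet_lt (mX.sub mY) measurable_const
  have m2 : MeasurableSet {ω | Y ω - X ω < 0} := measurableSet_lt (mY.sub mX) measurable_const
  have h3 := probReal_compl_eq_one_sub (μ := P) m1
  have h4 : P.real {ω | X ω - Y ω < 0}ᶜ = P.real {ω | Y ω - X ω < 0} := by
    apply le_antisymm
    · have : P.real ({ω | Y ω - X ω < 0} ∪ {ω | X ω = Y ω}) ≤ _ := measureReal_union_le _ _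
      rw [h2, add_zero] at this
      refine (measureReal_mono fun ω hω => ?_).trans this
      have hω : ¬ X ω - Y ω < 0 := hω
      rcases (not_lt.1 hω).lt_or_eq with h | h
      · exact Or.inl (show Y ω - X ω < 0 by linarith)
      · exact Or.inr (show X ω = Y ω by linarith)
    · refine measureReal_mono fun ω (hω : Y ω - X ω < 0) => ?_
      show ¬ X ω - Y ω < 0
      linarith
  rw [h4, ← h1] at h3
  change choiceProb P X Y 0 = 1 - choiceProb P X Y 0 at h3
  linarith

lemma choiceProb_gt (hγ : 0 < γ) {D : ℝ} (hD : 0 < D) : 1 / 2 < choiceProb P X Y D := by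
  -- The box `0 < X ≤ D / 2`, `-(D / 2) < Y ≤ 0` has positive probability and lies in `0 < X - Y <
  -- D`, which gives strictness over the value at zero.
  have m1 : MeasurableSet {ω | -(D / 2) < Y ω ∧ Y ω ≤ 0} :=
    (measurableSet_lt measurable_const mY).inter (measurableSet_le mY measurable_const)
  have h1 : P.real {ω | (0 < X ω ∧ X ω ≤ D / 2) ∧ -(D / 2) < Y ω ∧ Y ω ≤ 0}
      = P.real {ω | 0 < X ω ∧ X ω ≤ D / 2} * P.real {ω | -(D / 2) < Y ω ∧ Y ω ≤ 0} := by
    have := hind.measure_inter_preimage_eq_mul (Ioc 0 (D / 2)) (Ioc (-(D / 2)) 0)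
      measurableSet_Ioc measurableSet_Ioc
    have := congrArg ENNReal.toReal this
    rw [ENNReal.toReal_mul] at this
    exact this
  rw [hX.measureReal_Ioc mX (by linarith), hY.measureReal_Ioc mY (by linarith)] at h1
  have h2 := exp_neg_exp_lt hγ (by linarith : (0 : ℝ) < D / 2)
  have h3 := exp_neg_exp_lt hγ (by linarith : -(D / 2) < (0 : ℝ))
  have h4 := mul_pos (sub_pos.2 h2) (sub_pos.2 h3)
  rw [← h1] at h4
  have m0 : MeasurableSet {ω | X ω - Y ω < 0} := measurableSet_lt (mX.sub mY) measurable_const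
  have h5 : P.real ({ω | (0 < X ω ∧ X ω ≤ D / 2) ∧ -(D / 2) < Y ω ∧ Y ω ≤ 0} ∪ {ω | X ω - Y ω < 0})
      = _ := measureReal_union (by
      rw [Set.disjoint_left]
      rintro ω ⟨⟨h, -⟩, -, h'⟩ (h'' : X ω - Y ω < 0)
      linarith) m0
  have h6 : P.real ({ω | (0 < X ω ∧ X ω ≤ D / 2) ∧ -(D / 2) < Y ω ∧ Y ω ≤ 0} ∪ {ω | X ω - Y ω < 0})
      ≤ choiceProb P X Y D := by
    refine measureReal_mono ?_
    rintro ω (⟨⟨-, h⟩, h', -⟩ | h)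
    · show X ω - Y ω < D
      linarith
    · have h : X ω - Y ω < 0 := h
      show X ω - Y ω < D
      linarith
  have h7 := choiceProb_zero hX hY mX mY hind
  rw [choiceProb] at h7
  linarith

lemma choiceProb_le_one_sub {D D' : ℝ} (h : D' ≤ -D) :
    choiceProb P X Y D' ≤ 1 - choiceProb P X Y D := by
  have m0 : MeasurableSet {ω | X ω - Y ω < D} := measurableSet_lt (mX.sub mY) measurable_const
  rw [choiceProb_symm hX hY mX mY hind D', choiceProb, ← probReal_compl_eq_one_sub m0]
  refine measureReal_mono fun ω (hω : Y ω - X ω < D') => ?_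
  show ¬ X ω - Y ω < D
  linarith

lemma choiceProb_lt (hγ : 0 < γ) {D : ℝ} (hD : D < 0) : choiceProb P X Y D < 1 / 2 := by
  have h1 := choiceProb_gt hX hY mX mY hind hγ (neg_pos.2 hD)
  have h2 := choiceProb_le_one_sub hX hY mX mY hind (D := -D) (D' := D) (by simp)
  linarith

-- The event `X ≤ 0`, `Y > Δ` forces the choice whatever the utilities, as long as the disadvantage
-- is at most `Δ`; `exp (-1)` is the probability of `X ≤ 0`.
omit mX in
lemma le_choiceProb {D Δ : ℝ} (hD : -Δ ≤ D) :
    Real.exp (-1) * (1 - Real.exp (-Real.exp (-Δ / γ))) ≤ choiceProb P X Y D := by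
  have h1 : P.real {ω | X ω ≤ 0 ∧ Δ < Y ω} = P.real {ω | X ω ≤ 0} * P.real {ω | Δ < Y ω} := by
    have := hind.measure_inter_preimage_eq_mul (Iic 0) (Ioi Δ) measurableSet_Iic measurableSet_Ioi
    have := congrArg ENNReal.toReal this
    rw [ENNReal.toReal_mul] at this
    exact this
  have m1 : MeasurableSet {ω | Y ω ≤ Δ} := measurableSet_le mY measurable_const
  have h2 : {ω | Δ < Y ω} = {ω | Y ω ≤ Δ}ᶜ := by ext; simp
  rw [h2, probReal_compl_eq_one_sub m1, hX.measureReal_Iic, hY.measureReal_Iic] at h1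
  simp only [neg_zero, zero_div, Real.exp_zero] at h1
  rw [← h1]
  refine measureReal_mono ?_
  rintro ω ⟨h, h'⟩
  have h' : Δ < Y ω := h'
  show X ω - Y ω < D
  linarith

end Gumbel

lemma gap_pos {Δ γ : ℝ} :
    0 < Real.exp (-1) * (1 - Real.exp (-Real.exp (-Δ / γ))) := by
  apply mul_pos (Real.exp_pos _)
  rw [sub_pos, Real.exp_lt_one_iff]
  exact neg_lt_zero.2 (Real.exp_pos _)

/-! ### Utilities of the two options -/

/-- The utility gain of the right option over the left one. -/
noncomputable def advantage (d : ℝ → ℝ → ℝ) (θs : ℝ) (cm cp : ℝ → ℝ) (x : ℝ) : ℝ :=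
  d (cm x) θs - d (cp x) θs

lemma advantage_eq_zero {d : ℝ → ℝ → ℝ} {Δ β θs x : ℝ} {cm cp : ℝ → ℝ}
    (hc : IsComparisonPair d Δ β cm cp) (hx : x ∈ Icc (-β) β) (h : x = θs) :
    advantage d θs cm cp x = 0 := by
  obtain ⟨h1, h2, h3, h4⟩ := hc x hx
  rw [advantage, ← h, h3, h4, sub_self]

section Advantage

variable {d : ℝ → ℝ → ℝ} {Δ β θs x : ℝ} {cm cp : ℝ → ℝ} (hd : IsDistance d)
  (hc : IsComparisonPair d Δ β cm cp) (hx : x ∈ Icc (-β) β)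

include hd hc hx

lemma abs_advantage_le : |advantage d θs cm cp x| ≤ Δ := by
  obtain ⟨-, -, h1, h2⟩ := hc x hx
  have h3 := hd.triangle (cm x) (cp x) θs
  have h4 := hd.triangle (cp x) (cm x) θs
  have h5 := hd.triangle (cm x) x (cp x)
  rw [hd.symm x (cp x)] at h5
  rw [hd.symm (cp x) (cm x)] at h4
  rw [advantage, abs_le]
  constructor <;> linarith

/-- If the right option overshoots `θs`, it is nearer to `θs` than to `x`, so at distance below `Δ /
2`, while the left option is further than `Δ / 2` from `θs`. -/
lemma advantage_pos (hΔ : 0 < Δ) (h : x < θs) : 0 < advantage d θs cm cp x := by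
  obtain ⟨h1, h2, h3, h4⟩ := hc x hx
  have h5 := (hd.lt_of_between _ _ _ h1 h).1
  rw [advantage, sub_pos]
  rcases lt_trichotomy (cp x) θs with h6 | h6 | h6
  · exact (hd.lt_of_between _ _ _ (h1.trans h2) h6).2
  · rw [(hd.eq_zero_iff _ _).2 h6]; linarith
  · have := (hd.lt_of_between _ _ _ h h6).2
    rw [hd.symm θs, hd.symm x] at this
    linarith

lemma advantage_neg (hΔ : 0 < Δ) (h : θs < x) : advantage d θs cm cp x < 0 := by
  obtain ⟨h1, h2, h3, h4⟩ := hc x hx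
  have h5 := (hd.lt_of_between _ _ _ h h2).2
  rw [hd.symm x, hd.symm θs] at h5
  rw [advantage, sub_neg]
  rcases lt_trichotomy (cm x) θs with h6 | h6 | h6
  · have := (hd.lt_of_between _ _ _ h6 h).1
    linarith
  · rw [(hd.eq_zero_iff _ _).2 h6]; linarith
  · have := (hd.lt_of_between _ _ _ h6 (h1.trans h2)).1
    rwa [hd.symm θs, hd.symm θs] at this

end Advantage

/-! ### The outcome of a test -/

/-- A verdict as a sign. -/
def signOf (b : Bool) : SignType := if b then 1 else -1

/-- The event that the `k`-th test, at the query point `x`, has the outcome `b`. -/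
def outcome {Ω : Type*} (η : ℝ) (d : ℝ → ℝ → ℝ) (θs : ℝ) (cm cp : ℝ → ℝ)
    (ξ : ℕ → ℕ → Bool → Ω → ℝ) (k : ℕ) (x : ℝ) (b : Bool) : Set Ω :=
  {ω | verdict η (fun i => answer d θs cm cp x (fun s => ξ k i s ω)) = signOf b}

/-- The σ-algebra of the noises in the tests with index in `S`. -/
abbrev noiseAlgebra {Ω : Type*} (ξ : ℕ → ℕ → Bool → Ω → ℝ) (S : Set (ℕ × ℕ × Bool)) :
    MeasurableSpace Ω :=
  ⨆ j ∈ S, MeasurableSpace.comap (ξ j.1 j.2.1 j.2.2) inferInstance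

lemma noiseAlgebra_mono {Ω : Type*} (ξ : ℕ → ℕ → Bool → Ω → ℝ) {S T : Set (ℕ × ℕ × Bool)}
    (h : S ⊆ T) : noiseAlgebra ξ S ≤ noiseAlgebra ξ T := biSup_mono h

lemma measurable_noise {Ω : Type*} (ξ : ℕ → ℕ → Bool → Ω → ℝ) {S : Set (ℕ × ℕ × Bool)} {k i : ℕ}
    {s : Bool} (h : (k, i, s) ∈ S) : Measurable[noiseAlgebra ξ S] (ξ k i s) := by
  have hle : MeasurableSpace.comap (ξ k i s) inferInstance ≤ noiseAlgebra ξ S :=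
    le_biSup (fun j : ℕ × ℕ × Bool => MeasurableSpace.comap (ξ j.1 j.2.1 j.2.2) inferInstance) h
  exact Measurable.mono (comap_measurable (ξ k i s)) hle le_rfl

lemma measurable_answer {Ω : Type*} {d : ℝ → ℝ → ℝ} {θs x : ℝ} {cm cp : ℝ → ℝ}
    (ξ : ℕ → ℕ → Bool → Ω → ℝ) {S : Set (ℕ × ℕ × Bool)} {k i : ℕ} (h : ∀ s, (k, i, s) ∈ S) :
    Measurable[noiseAlgebra ξ S] fun ω => answer d θs cm cp x (fun s => ξ k i s ω) := by
  let _ := noiseAlgebra ξ S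
  have h1 : Measurable (ξ k i true) := measurable_noise ξ (h true)
  have h2 : Measurable (ξ k i false) := measurable_noise ξ (h false)
  unfold answer
  exact Measurable.ite (measurableSet_lt (h2.const_add _) (h1.const_add _)) measurable_const
    measurable_const

lemma measurableSet_outcome {Ω : Type*} {η : ℝ} {d : ℝ → ℝ → ℝ} {θs x : ℝ} {cm cp : ℝ → ℝ}
    (ξ : ℕ → ℕ → Bool → Ω → ℝ) (k : ℕ) (b : Bool) :
    MeasurableSet[noiseAlgebra ξ {j | j.1 = k}] (outcome η d θs cm cp ξ k x b) := by
  let _ := noiseAlgebra ξ {j | j.1 = k}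
  have h1 : Measurable fun ω (i : ℕ) => answer d θs cm cp x (fun s => ξ k i s ω) :=
    measurable_pi_lambda _ fun i => measurable_answer ξ fun s => rfl
  exact h1 (measurableSet_verdict_eq η (signOf b) (by cases b <;> decide))

section Noise

variable {Ω : Type*} [MeasurableSpace Ω] {P : Measure Ω} [IsProbabilityMeasure P] {γ : ℝ}
  {ξ : ℕ → ℕ → Bool → Ω → ℝ} {d : ℝ → ℝ → ℝ} {Δ η β θs x : ℝ} {cm cp : ℝ → ℝ}

/-- At a fixed query point different comparisons use disjoint pairs of noises. The bias is expressed
by the noises of the very first comparison, so it is the same for all tests. -/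
lemma isCoin_answer (mξ : ∀ k i s, Measurable (ξ k i s))
    (hind : iIndepFun (fun j : ℕ × ℕ × Bool => ξ j.1 j.2.1 j.2.2) P)
    (hξ : ∀ k i s, IsGumbel P γ (ξ k i s)) (k : ℕ) :
    IsCoin P (fun i ω => answer d θs cm cp x (fun s => ξ k i s ω))
      (choiceProb P (ξ 0 0 false) (ξ 0 0 true) (advantage d θs cm cp x)) := by
  have hle : ∀ S, noiseAlgebra ξ S ≤ (inferInstance : MeasurableSpace Ω) := fun S =>
    iSup₂_le fun j _ => (mξ j.1 j.2.1 j.2.2).comap_le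
  have hm : ∀ i, Measurable fun ω => answer d θs cm cp x (fun s => ξ k i s ω) := fun i =>
    (measurable_answer ξ (S := univ) fun s => mem_univ _).mono (hle _) le_rfl
  have hpair : ∀ k i, IndepFun (ξ k i false) (ξ k i true) P := fun k i =>
    hind.indepFun (i := (k, i, false)) (j := (k, i, true)) (by simp)
  have hid : ∀ k i k' i', IdentDistrib (fun ω => (ξ k i false ω, ξ k i true ω))
      (fun ω => (ξ k' i' false ω, ξ k' i' true ω)) P P := fun k i k' i' =>
    ((hξ k i false).identDistrib (hξ k' i' false) (mξ _ _ _) (mξ _ _ _)).prodMk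
      ((hξ k i true).identDistrib (hξ k' i' true) (mξ _ _ _) (mξ _ _ _)) (hpair k i) (hpair k' i')
  have hval : ∀ (e : Bool → ℝ), answer d θs cm cp x e
      = (open Classical in if e false - e true < advantage d θs cm cp x then (1 : ℝ) else -1) := by
    intro e
    rw [answer]
    congr 1
    simp only [utility, advantage, eq_iff_iff]
    constructor <;> intro h <;> linarith
  refine ⟨hm, ?_, fun i => ?_, fun i ω => ?_, fun i => ?_⟩
  · refine iIndepFun_of_disjoint (fun j : ℕ × ℕ × Bool => mξ j.1 j.2.1 j.2.2) hind
      (S := fun i => {j | j.1 = k ∧ j.2.1 = i}) ?_ fun i => measurable_answer ξ fun s => ⟨rfl, rfl⟩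
    intro a b hab
    rw [Set.disjoint_left]
    rintro j ⟨-, h1⟩ ⟨-, h2⟩
    exact hab (h1.symm.trans h2)
  · classical
    have hg : Measurable fun z : ℝ × ℝ => if z.1 - z.2 < advantage d θs cm cp x then (1 : ℝ) else -1 :=
      Measurable.ite (measurableSet_lt (measurable_fst.sub measurable_snd) measurable_const)
        measurable_const measurable_const
    have := (hid k i k 0).comp hg
    simp only [hval]
    convert this using 1 <;> ext ω <;> simp only [Function.comp]
  · rw [answer]; split_ifs <;> simp
  · have hm : MeasurableSet {z : ℝ × ℝ | z.1 - z.2 < advantage d θs cm cp x} :=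
      measurableSet_lt (measurable_fst.sub measurable_snd) measurable_const
    have h1 := congrArg ENNReal.toReal ((hid k i 0 0).measure_mem_eq hm)
    refine Eq.trans ?_ h1
    show P.real _ = P.real _
    congr 1
    ext ω
    simp only [hval, mem_ofPred_eq, mem_preimage]
    split_ifs with h
    · simp [h]
    · simp [h]; norm_num

/-- The probabilities of the two outcomes of a test, in terms of the position of the query point. -/
structure OutcomeBounds (P : Measure Ω) (O : Bool → Set Ω) (e ε x θs : ℝ) : Prop where
  add_le : P.real (O true) + P.real (O false) ≤ 1
  left : x < θs → P.real (O false) ≤ e ∧ ε ≤ P.real (O false) ∧ ∀ᵐ ω ∂P, ω ∈ O true ∨ ω ∈ O false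
  center : x = θs → P.real (O true) ≤ e ∧ P.real (O false) ≤ e
  right : θs < x → P.real (O true) ≤ e ∧ ε ≤ P.real (O true) ∧ ∀ᵐ ω ∂P, ω ∈ O true ∨ ω ∈ O false

lemma outcomeBounds (hη : 0 < η) (hη1 : η < 1) (hΔ : 0 < Δ) (hγ : 0 < γ) (hd : IsDistance d)
    (hc : IsComparisonPair d Δ β cm cp) (mξ : ∀ k i s, Measurable (ξ k i s))
    (hind : iIndepFun (fun j : ℕ × ℕ × Bool => ξ j.1 j.2.1 j.2.2) P)
    (hξ : ∀ k i s, IsGumbel P γ (ξ k i s)) {m : ℕ} (hm : 1 ≤ m) (hb : boundary η m ≤ m)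
    (hx : x ∈ Icc (-β) β) (k : ℕ) :
    OutcomeBounds P (outcome η d θs cm cp ξ k x) (η / 2)
      ((Real.exp (-1) * (1 - Real.exp (-Real.exp (-Δ / γ)))) ^ m) x θs := by
  have hcoin := isCoin_answer (d := d) (θs := θs) (cm := cm) (cp := cp) (x := x) mξ hind hξ k
  have i1 := hξ 0 0 false
  have i2 := hξ 0 0 true
  have i3 := mξ 0 0 false
  have i4 := mξ 0 0 true
  have i5 : IndepFun (ξ 0 0 false) (ξ 0 0 true) P :=
    hind.indepFun (i := (0, 0, false)) (j := (0, 0, true)) (by simp)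
  have hab := abs_le.1 (abs_advantage_le (θs := θs) hd hc hx)
  have hgap := (gap_pos (Δ := Δ) (γ := γ)).le
  have g1 := le_choiceProb i1 i2 i4 i5 hab.1
  -- Reflection turns the lower bound for the opposite advantage into one for the probability of the
  -- answer `-1`.
  have g2 := (le_choiceProb i1 i2 i4 i5 (neg_le_neg hab.2)).trans
    (choiceProb_le_one_sub i1 i2 i3 i4 i5 (D := advantage d θs cm cp x) le_rfl)
  have hdec : ∀ q : ℝ, q ≠ 1 / 2 → IsCoin P (fun i ω => answer d θs cm cp x (fun s => ξ k i s ω)) q →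
      ∀ᵐ ω ∂P, ω ∈ outcome η d θs cm cp ξ k x true ∨ ω ∈ outcome η d θs cm cp ξ k x false := by
    intro q hq hcq
    filter_upwards [hcq.ae_verdict_ne_zero hη hη1 hq] with ω hω
    show verdict η _ = 1 ∨ verdict η _ = -1
    revert hω
    generalize verdict η (fun i => answer d θs cm cp x (fun s => ξ k i s ω)) = v
    revert v; decide
  refine ⟨?_, fun h => ?_, fun h => ?_, fun h => ?_⟩
  · have hle : noiseAlgebra ξ {j | j.1 = k} ≤ (inferInstance : MeasurableSpace Ω) :=
      iSup₂_le fun j _ => (mξ j.1 j.2.1 j.2.2).comap_le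
    rw [← measureReal_union _ (hle _ (measurableSet_outcome ξ k false))]
    · exact measureReal_le_one
    · rw [Set.disjoint_left]
      intro ω (h1 : verdict η _ = signOf true) (h2 : verdict η _ = signOf false)
      rw [h1] at h2
      exact absurd h2 (by decide)
  · have hq := choiceProb_gt i1 i2 i3 i4 i5 hγ (advantage_pos hd hc hx hΔ h)
    exact ⟨hcoin.verdict_neg_le hη hη1 hq.le,
      (pow_le_pow_left₀ hgap g2 m).trans (hcoin.le_verdict_neg hm hb), hdec _ hq.ne' hcoin⟩
  · have hq := choiceProb_zero i1 i2 i3 i4 i5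
    rw [← advantage_eq_zero (θs := θs) hc hx h] at hq
    exact ⟨hcoin.verdict_pos_le hη hη1 hq.le, hcoin.verdict_neg_le hη hη1 hq.ge⟩
  · have hq := choiceProb_lt i1 i2 i3 i4 i5 hγ (advantage_neg hd hc hx hΔ h)
    exact ⟨hcoin.verdict_pos_le hη hη1 hq.le,
      (pow_le_pow_left₀ hgap g1 m).trans (hcoin.le_verdict_pos hm hb), hdec _ hq.ne hcoin⟩

end Noise


/-! ### Medians and the update of the density -/

/-- The distribution function of the distribution with density `ρ`. -/
noncomputable def massBelow (β : ℝ) (ρ : ℝ → ℝ) (t : ℝ) : ℝ := (densityMeasure β ρ).real (Iic t)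

section Median

variable {β : ℝ} {ρ : ℝ → ℝ}

lemma IsPriorDensity.isProbabilityMeasure (hρ : IsPriorDensity β ρ) :
    IsProbabilityMeasure (densityMeasure β ρ) := ⟨hρ.mass⟩

lemma densityMeasure_singleton (β : ℝ) (ρ : ℝ → ℝ) (x : ℝ) : densityMeasure β ρ {x} = 0 := by
  refine withDensity_absolutelyContinuous _ _ ?_
  exact le_antisymm ((Measure.restrict_apply_le _ _).trans (by simp)) bot_le

lemma densityMeasure_compl (β : ℝ) (ρ : ℝ → ℝ) : densityMeasure β ρ (Icc (-β) β)ᶜ = 0 := by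
  refine withDensity_absolutelyContinuous _ _ ?_
  rw [Measure.restrict_apply measurableSet_Icc.compl]
  simp

instance densityMeasure.nullSingletonClass (β : ℝ) (ρ : ℝ → ℝ) :
    NullSingletonClass (densityMeasure β ρ) :=
  ⟨densityMeasure_singleton β ρ⟩

lemma massBelow_left (β : ℝ) (ρ : ℝ → ℝ) : massBelow β ρ (-β) = 0 := by
  have : densityMeasure β ρ (Iic (-β)) = 0 := by
    refine measure_mono_null (t := (Icc (-β) β)ᶜ ∪ {-β}) ?_ ?_
    · intro x hx
      rcases (mem_Iic.1 hx).lt_or_eq with h | h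
      · exact Or.inl fun h' => absurd h'.1 (not_le.2 h)
      · exact Or.inr h
    · exact measure_union_null (densityMeasure_compl β ρ) (densityMeasure_singleton β ρ _)
  rw [massBelow, Measure.real, this]; rfl

lemma massBelow_nonneg (β : ℝ) (ρ : ℝ → ℝ) (t : ℝ) : 0 ≤ massBelow β ρ t := measureReal_nonneg

variable (hρ : IsPriorDensity β ρ)
include hρ

lemma IsPriorDensity.measureReal_Ioc {s t : ℝ} (h : s ≤ t) :
    (densityMeasure β ρ).real (Ioc s t) = massBelow β ρ t - massBelow β ρ s := by
  have := hρ.isProbabilityMeasure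
  rw [massBelow, massBelow, ← measureReal_sdiff (Iic_subset_Iic.2 h) measurableSet_Iic]
  congr 1; ext x; simp [and_comm]

lemma IsPriorDensity.massBelow_mono {s t : ℝ} (h : s ≤ t) : massBelow β ρ s ≤ massBelow β ρ t := by
  have := hρ.isProbabilityMeasure
  exact measureReal_mono (Iic_subset_Iic.2 h)

lemma IsPriorDensity.massBelow_lt {s t : ℝ} (hs : -β ≤ s) (ht : t ≤ β) (h : s < t) :
    massBelow β ρ s < massBelow β ρ t := by
  have := hρ.isProbabilityMeasure
  rw [← sub_pos, ← hρ.measureReal_Ioc h.le]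
  refine measureReal_nonneg.lt_of_ne fun h0 => ?_
  have h1 : densityMeasure β ρ (Ioc s t) = 0 := (measureReal_eq_zero_iff).1 h0.symm
  rw [densityMeasure, withDensity_apply_eq_zero hρ.measurable.ennreal_ofReal,
    Measure.restrict_apply] at h1
  · have h2 : Ioc s t ⊆ ({x | ENNReal.ofReal (ρ x) ≠ 0} ∩ Ioc s t) ∩ Icc (-β) β := by
      intro x hx
      have hx' : x ∈ Icc (-β) β := ⟨hs.trans hx.1.le, hx.2.trans ht⟩
      exact ⟨⟨(ENNReal.ofReal_pos.2 (hρ.pos x hx')).ne', hx⟩, hx'⟩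
    have h3 := measure_mono_null h2 h1
    rw [Real.volume_Ioc, ENNReal.ofReal_eq_zero] at h3
    linarith
  · exact (hρ.measurable.ennreal_ofReal (measurableSet_singleton 0).compl).inter measurableSet_Ioc

lemma IsPriorDensity.massBelow_right {t : ℝ} (ht : β ≤ t) : massBelow β ρ t = 1 := by
  have := hρ.isProbabilityMeasure
  have h1 : densityMeasure β ρ (Iic t)ᶜ = 0 :=
    measure_mono_null (compl_subset_compl.2 fun x hx => hx.2.trans ht) (densityMeasure_compl β ρ)
  rw [massBelow, Measure.real, (prob_compl_eq_zero_iff measurableSet_Iic).1 h1]; rfl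

lemma IsPriorDensity.massBelow_le_one (t : ℝ) : massBelow β ρ t ≤ 1 := by
  have := hρ.isProbabilityMeasure
  exact measureReal_le_one

/-- The intermediate value theorem, with continuity obtained by writing the distribution function as
the primitive of `1` against an atomless measure. -/
lemma IsPriorDensity.exists_half (hβ : 0 < β) :
    ∃ c ∈ Icc (-β) β, massBelow β ρ c = 1 / 2 := by
  have := hρ.isProbabilityMeasure
  set G : ℝ → ℝ := fun t => ∫ _ in (-β)..t, (1 : ℝ) ∂(densityMeasure β ρ) with hG
  have hc : Continuous G := intervalIntegral.continuous_primitive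
    (fun a b => ⟨integrable_const _, integrable_const _⟩) _
  have hGe : ∀ t ∈ Icc (-β) β, G t = massBelow β ρ t := by
    intro t ht
    rw [hG]
    simp only
    rw [intervalIntegral.integral_const', Ioc_eq_empty_of_le ht.1, hρ.measureReal_Ioc ht.1,
      massBelow_left]
    simp
  have hle : -β ≤ β := by linarith
  obtain ⟨c, hc1, hc2⟩ := intermediate_value_Icc hle hc.continuousOn
    (show (1 / 2 : ℝ) ∈ Icc (G (-β)) (G β) by
      rw [hGe _ (left_mem_Icc.2 hle), hGe _ (right_mem_Icc.2 hle), massBelow_left,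
        hρ.massBelow_right le_rfl]
      norm_num)
  exact ⟨c, hc1, by rw [← hGe c hc1, hc2]⟩

/-- Positivity of the density makes the distribution function strictly increasing on the interval,
so the set whose infimum is the median is exactly `[c, β]`. -/
lemma IsPriorDensity.median_spec (hβ : 0 < β) :
    median β ρ ∈ Icc (-β) β ∧ massBelow β ρ (median β ρ) = 1 / 2 := by
  have := hρ.isProbabilityMeasure
  obtain ⟨c, hc, hF⟩ := hρ.exists_half hβ
  have h1 : {x | x ∈ Icc (-β) β ∧ 1 / 2 ≤ densityMeasure β ρ (Iic x)} = Icc c β := by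
    ext x
    have e : (1 / 2 : ℝ≥0∞) ≤ densityMeasure β ρ (Iic x) ↔ 1 / 2 ≤ massBelow β ρ x := by
      rw [massBelow, Measure.real, ← ENNReal.toReal_le_toReal (by simp) (measure_ne_top _ _)]
      simp
    rw [mem_ofPred_eq, e]
    constructor
    · rintro ⟨hx, h⟩
      refine ⟨not_lt.1 fun hlt => ?_, hx.2⟩
      have := hρ.massBelow_lt hx.1 hc.2 hlt
      linarith
    · rintro hx
      exact ⟨⟨hc.1.trans hx.1, hx.2⟩, hF ▸ hρ.massBelow_mono hx.1⟩
  have h2 : median β ρ = c := by rw [median, h1, csInf_Icc hc.2]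
  rw [h2]; exact ⟨hc, hF⟩

lemma IsPriorDensity.median_le_iff (hβ : 0 < β) {t : ℝ} (ht : t ∈ Icc (-β) β) :
    median β ρ ≤ t ↔ 1 / 2 ≤ massBelow β ρ t := by
  obtain ⟨h1, h2⟩ := hρ.median_spec hβ
  constructor
  · intro h; rw [← h2]; exact hρ.massBelow_mono h
  · intro h
    by_contra hlt
    have := hρ.massBelow_lt ht.1 h1.2 (not_le.1 hlt)
    linarith

lemma IsPriorDensity.le_median_iff (hβ : 0 < β) {t : ℝ} (ht : t ∈ Icc (-β) β) :
    t ≤ median β ρ ↔ massBelow β ρ t ≤ 1 / 2 := by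
  obtain ⟨h1, h2⟩ := hρ.median_spec hβ
  constructor
  · intro h; rw [← h2]; exact hρ.massBelow_mono h
  · intro h
    by_contra hlt
    have := hρ.massBelow_lt h1.1 ht.2 (not_le.1 hlt)
    linarith

end Median

/-- The factor, divided by two, by which the mass to the left of the query point is multiplied. -/
noncomputable def leftFactor (p : ℝ) (b : Bool) : ℝ := if b then 1 - p else p

lemma leftFactor_pos {p : ℝ} (h0 : 0 < p) (h1 : p < 1) (b : Bool) : 0 < leftFactor p b := by
  cases b <;> simp [leftFactor, h0, h1]

lemma leftFactor_lt_one {p : ℝ} (h0 : 0 < p) (h1 : p < 1) (b : Bool) : leftFactor p b < 1 := by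
  cases b <;> simp [leftFactor, h0, h1]

open Classical in
lemma update_apply (p x : ℝ) (b : Bool) (ρ : ℝ → ℝ) (y : ℝ) : update p x (signOf b) ρ y
    = if x ≤ y then 2 * (1 - leftFactor p b) * ρ y else 2 * leftFactor p b * ρ y := by
  cases b
  · have : ¬ (-1 : SignType) = 1 := by decide
    simp [update, signOf, leftFactor, this]
  · simp [update, signOf, leftFactor]

lemma measurable_update {ρ : ℝ → ℝ} (hρ : Measurable ρ) (p x : ℝ) (b : Bool) :
    Measurable (update p x (signOf b) ρ) := by
  classical
  have : update p x (signOf b) ρ = fun y => if x ≤ y then 2 * (1 - leftFactor p b) * ρ y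
      else 2 * leftFactor p b * ρ y := funext fun y => update_apply p x b ρ y
  rw [this]
  exact Measurable.ite (measurableSet_le measurable_const measurable_id) (hρ.const_mul _)
    (hρ.const_mul _)

lemma densityMeasure_update {β : ℝ} {ρ : ℝ → ℝ} (hρ : Measurable ρ) {p : ℝ} (h0 : 0 < p)
    (h1 : p < 1) (x : ℝ) (b : Bool) {E : Set ℝ} (hE : MeasurableSet E) :
    densityMeasure β (update p x (signOf b) ρ) E
      = ENNReal.ofReal (2 * leftFactor p b) * densityMeasure β ρ (E ∩ Iio x)
        + ENNReal.ofReal (2 * (1 - leftFactor p b)) * densityMeasure β ρ (E \ Iio x) := by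
  have hl := leftFactor_pos h0 h1 b
  have hl1 := leftFactor_lt_one h0 h1 b
  rw [densityMeasure, densityMeasure, withDensity_apply _ hE,
    withDensity_apply _ (hE.inter measurableSet_Iio), withDensity_apply _ (hE.diff measurableSet_Iio),
    ← lintegral_inter_add_sdiff _ _ measurableSet_Iio]
  congr 1
  · rw [← lintegral_const_mul _ hρ.ennreal_ofReal]
    refine setLIntegral_congr_fun (hE.inter measurableSet_Iio) fun y hy => ?_
    simp only [update_apply, if_neg (not_le.2 (mem_Iio.1 hy.2))]
    rw [ENNReal.ofReal_mul (by linarith)]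
  · rw [← lintegral_const_mul _ hρ.ennreal_ofReal]
    refine setLIntegral_congr_fun (hE.diff measurableSet_Iio) fun y hy => ?_
    simp only [update_apply, if_pos (not_lt.1 fun h => hy.2 (mem_Iio.2 h))]
    rw [ENNReal.ofReal_mul (by linarith)]

/-- The update at the median acts on the distribution function by `push`. -/
lemma IsPriorDensity.measureReal_update {β : ℝ} {ρ : ℝ → ℝ} (hρ : IsPriorDensity β ρ) (hβ : 0 < β)
    {p : ℝ} (h0 : 0 < p) (h1 : p < 1) (b : Bool) (t : ℝ) :
    massBelow β (update p (median β ρ) (signOf b) ρ) t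
      = push (leftFactor p b) (massBelow β ρ t) := by
  have := hρ.isProbabilityMeasure
  have hl := leftFactor_pos h0 h1 b
  have hl1 := leftFactor_lt_one h0 h1 b
  obtain ⟨-, hF⟩ := hρ.median_spec hβ
  set x := median β ρ
  have e1 : massBelow β (update p x (signOf b) ρ) t
      = 2 * leftFactor p b * (densityMeasure β ρ).real (Iic t ∩ Iio x)
        + 2 * (1 - leftFactor p b) * (densityMeasure β ρ).real (Iic t \ Iio x) := by
    rw [massBelow, Measure.real, densityMeasure_update hρ.measurable h0 h1 x b measurableSet_Iic,
      ENNReal.toReal_add (ENNReal.mul_ne_top ENNReal.ofReal_ne_top (measure_ne_top _ _))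
        (ENNReal.mul_ne_top ENNReal.ofReal_ne_top (measure_ne_top _ _)),
      ENNReal.toReal_mul, ENNReal.toReal_mul, ENNReal.toReal_ofReal (by linarith),
      ENNReal.toReal_ofReal (by linarith)]
    rfl
  -- The point `x` has no mass, so the side on which the update puts it is irrelevant.
  have e2 : (densityMeasure β ρ).real (Iic t ∩ Iio x) = massBelow β ρ (min t x) := by
    rw [massBelow, ← Iic_inter_Iic]
    refine measureReal_congr (Filter.EventuallyEq.rfl.inter Iio_ae_eq_Iic)
  have e3 : (densityMeasure β ρ).real (Iic t ∩ Iio x) + (densityMeasure β ρ).real (Iic t \ Iio x)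
      = massBelow β ρ t := measureReal_inter_add_sdiff measurableSet_Iio
  rw [e1]
  rw [e2] at *
  rcases le_total t x with h | h
  · rw [min_eq_left h] at *
    have hle := hρ.massBelow_mono h
    rw [push_of_le (by linarith)]
    have : (densityMeasure β ρ).real (Iic t \ Iio x) = 0 := by linarith
    rw [this]; ring
  · rw [min_eq_right h] at *
    have hle := hρ.massBelow_mono h
    rw [push_of_ge (by linarith)]
    have : (densityMeasure β ρ).real (Iic t \ Iio x) = massBelow β ρ t - 1 / 2 := by linarith
    rw [this, hF]; ring

lemma IsPriorDensity.update {β : ℝ} {ρ : ℝ → ℝ} (hρ : IsPriorDensity β ρ) (hβ : 0 < β)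
    {p : ℝ} (h0 : 0 < p) (h1 : p < 1) (b : Bool) :
    IsPriorDensity β (BisectionMedians.update p (median β ρ) (signOf b) ρ) where
  measurable := measurable_update hρ.measurable _ _ _
  pos y hy := by
    have := hρ.pos y hy
    have hl := leftFactor_pos h0 h1 b
    have hl1 := sub_pos.2 (leftFactor_lt_one h0 h1 b)
    rw [update_apply]
    split_ifs <;> positivity
  mass := by
    have h := hρ.measureReal_update hβ h0 h1 b β
    rw [hρ.massBelow_right le_rfl, push_of_ge (by norm_num)] at h
    set μ := densityMeasure β (BisectionMedians.update p (median β ρ) (signOf b) ρ) with hμ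
    have h2 : μ univ = μ (Iic β) := by
      apply le_antisymm _ (measure_mono (subset_univ _))
      have : (univ : Set ℝ) = Iic β ∪ (Icc (-β) β)ᶜ := by
        refine (eq_univ_of_forall fun y => ?_).symm
        by_cases hy : y ≤ β
        · exact Or.inl hy
        · exact Or.inr fun h => hy h.2
      rw [this]
      refine (measure_union_le _ _).trans ?_
      rw [hμ, densityMeasure_compl, add_zero]
    have h3 : (μ (Iic β)).toReal = 1 := by
      change massBelow _ _ _ = 1
      rw [h]; ring
    rw [h2, ← ENNReal.toReal_eq_one_iff, h3]


/-! ### Settling times -/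

-- The settling time counts the `k` after which an exit from `S` is still to come; the sum is
-- infinite if exits never cease.
open Classical in
lemma settleTime_le_tsum (x : ℕ → ℝ) (S : Set ℝ) :
    settleTime x S ≤ ∑' k : ℕ, if ∃ j, k ≤ j ∧ x j ∉ S then (1 : ℝ≥0∞) else 0 := by
  by_cases h : ∃ n, ∀ k, n ≤ k → x k ∈ S
  · refine (iInf₂_le (Nat.find h) (Nat.find_spec h)).trans ?_
    refine le_trans (le_of_eq ?_) (ENNReal.sum_le_tsum (Finset.range (Nat.find h)))
    rw [Finset.sum_congr rfl fun k hk => if_pos (by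
      have := Nat.find_min h (Finset.mem_range.1 hk)
      push Not at this
      exact this)]
    simp
  · push Not at h
    rw [tsum_congr fun k => if_pos (h k)]
    simp

/-- Exponentially small probabilities of being outside a set give an integrable bound on the settling
time. -/
lemma exists_settleTime_le {Ω : Type*} [MeasurableSpace Ω] {P : Measure Ω}
    [IsProbabilityMeasure P] {x : Ω → ℕ → ℝ} {S : Set ℝ} {ν m : ℝ} (hν : 0 < ν) (hν1 : ν < 1)
    (hm : 0 < m) (h : ∀ k, P {ω | x ω k ∉ S} ≤ ENNReal.ofReal (2 * ν ^ (4 * k) / m ^ 2)) :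
    ∃ g : Ω → ℝ≥0∞, Measurable g ∧ (∀ ω, settleTime (x ω) S ≤ g ω) ∧
      ∫⁻ ω, g ω ∂P ≤ ENNReal.ofReal (2 / (1 - ν ^ 4) / (1 - ν) * (1 / Real.sqrt m)) := by
  classical
  have h4 : ν ^ 4 < 1 := pow_lt_one₀ hν.le hν1 (by norm_num)
  have h40 : 0 < ν ^ 4 := by positivity
  set D : ℕ → Set Ω := fun k => {ω | ∃ j, k ≤ j ∧ x ω j ∉ S} with hD
  set K := 2 / (1 - ν ^ 4) with hK
  have hK1 : 1 ≤ K := by rw [hK, le_div_iff₀ (by linarith)]; linarith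
  have hsm : 0 < Real.sqrt m := Real.sqrt_pos.2 hm
  have hs4 : Real.sqrt m ^ 4 = m ^ 2 := by
    calc Real.sqrt m ^ 4 = (Real.sqrt m ^ 2) ^ 2 := by ring
      _ = _ := by rw [Real.sq_sqrt hm.le]
  have hPD : ∀ k, P (D k) ≤ ENNReal.ofReal (K * (1 / Real.sqrt m) * ν ^ k) := by
    intro k
    -- The union bound over later times is at most `w ^ 4`, because `K ≥ 1`. When `w < 1` this is at
    -- most `w`, and otherwise `w` bounds any probability; thus `1 / m ^ 2` is traded for `1 / √m`.
    set w := K * (1 / Real.sqrt m) * ν ^ k with hw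
    have hw0 : 0 < w := by positivity
    rcases le_or_gt 1 w with h1 | h1
    · exact prob_le_one.trans (by simpa using ENNReal.ofReal_le_ofReal h1)
    · have hsub : D k ⊆ ⋃ i : ℕ, {ω | x ω (k + i) ∉ S} := by
        rintro ω ⟨j, hj, hjS⟩
        obtain ⟨i, rfl⟩ := Nat.exists_eq_add_of_le hj
        exact mem_iUnion.2 ⟨i, hjS⟩
      have hg := (hasSum_geometric_of_lt_one h40.le h4).mul_left (2 * ν ^ (4 * k) / m ^ 2)
      calc P (D k) ≤ ∑' i, P {ω | x ω (k + i) ∉ S} :=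
            (measure_mono hsub).trans (measure_iUnion_le _)
        _ ≤ ∑' i, ENNReal.ofReal (2 * ν ^ (4 * k) / m ^ 2 * (ν ^ 4) ^ i) := by
            refine ENNReal.tsum_le_tsum fun i => (h (k + i)).trans_eq ?_
            congr 1
            rw [mul_add, pow_add, pow_mul ν 4 i]; ring
        _ = ENNReal.ofReal (2 * ν ^ (4 * k) / m ^ 2 * (1 - ν ^ 4)⁻¹) := by
            rw [← ENNReal.ofReal_tsum_of_nonneg (fun i => by positivity) hg.summable, hg.tsum_eq]
        _ ≤ ENNReal.ofReal w := by
            apply ENNReal.ofReal_le_ofReal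
            have e1 : 2 * ν ^ (4 * k) / m ^ 2 * (1 - ν ^ 4)⁻¹
                = K * ((1 / Real.sqrt m) * ν ^ k) ^ 4 := by
              rw [hK, ← hs4, mul_comm 4 k, pow_mul, mul_pow, div_pow, one_pow]; ring
            have e2 : w ^ 4 = K ^ 3 * (K * ((1 / Real.sqrt m) * ν ^ k) ^ 4) := by rw [hw]; ring
            have h5 : 1 ≤ K ^ 3 := one_le_pow₀ hK1
            have h6 : 0 ≤ K * ((1 / Real.sqrt m) * ν ^ k) ^ 4 := by positivity
            have h7 : w ^ 4 ≤ w ^ 1 := pow_le_pow_of_le_one hw0.le h1.le (by norm_num)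
            rw [e1]
            nlinarith
  -- Measurable hulls provide a measurable majorant without measurability of the query points.
  have hpt : ∀ ω, settleTime (x ω) S ≤ ∑' k : ℕ, (toMeasurable P (D k)).indicator 1 ω := by
    intro ω
    refine (settleTime_le_tsum (x ω) S).trans (ENNReal.tsum_le_tsum fun k => ?_)
    split_ifs with hk
    · rw [indicator_of_mem (subset_toMeasurable P (D k) hk)]; rfl
    · exact bot_le
  have hg := (hasSum_geometric_of_lt_one hν.le hν1).mul_left (K * (1 / Real.sqrt m))
  refine ⟨_, Measurable.tsum fun k =>
    measurable_one.indicator (measurableSet_toMeasurable P (D k)), hpt, ?_⟩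
  calc ∫⁻ ω, ∑' k : ℕ, (toMeasurable P (D k)).indicator 1 ω ∂P
      = ∑' k, P (D k) := by
        rw [lintegral_tsum fun k =>
          (measurable_one.indicator (measurableSet_toMeasurable P (D k))).aemeasurable]
        refine tsum_congr fun k => ?_
        rw [lintegral_indicator_one (measurableSet_toMeasurable P (D k)), measure_toMeasurable]
    _ ≤ ∑' k, ENNReal.ofReal (K * (1 / Real.sqrt m) * ν ^ k) := ENNReal.tsum_le_tsum hPD
    _ = ENNReal.ofReal (K / (1 - ν) * (1 / Real.sqrt m)) := by
        rw [← ENNReal.ofReal_tsum_of_nonneg (fun i => by positivity) hg.summable, hg.tsum_eq]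
        congr 1; ring

/-! ### The tree of the possible runs -/

/-- The density after the outcomes `h`. -/
noncomputable def densityAt (β p : ℝ) (ρ₀ : ℝ → ℝ) : List Bool → ℝ → ℝ
  | [] => ρ₀
  | b :: t => update p (median β (densityAt β p ρ₀ t)) (signOf b) (densityAt β p ρ₀ t)

/-- The event that the outcomes of the first tests are `h`, where `O h b` is the event that the
test after the outcomes `h` has the outcome `b`. -/
def reached {Ω : Type*} (O : List Bool → Bool → Set Ω) : List Bool → Set Ω
  | [] => univ
  | b :: t => reached O t ∩ O t b

/-- The event that the test after the outcomes `h` has the outcome `b`. -/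
def outcomeAfter {Ω : Type*} (η p β : ℝ) (d : ℝ → ℝ → ℝ) (θs : ℝ) (cm cp ρ₀ : ℝ → ℝ)
    (ξ : ℕ → ℕ → Bool → Ω → ℝ) (h : List Bool) (b : Bool) : Set Ω :=
  outcome η d θs cm cp ξ h.length (median β (densityAt β p ρ₀ h)) b

lemma isPriorDensity_densityAt {β p : ℝ} {ρ₀ : ℝ → ℝ} (hρ : IsPriorDensity β ρ₀) (hβ : 0 < β)
    (h0 : 0 < p) (h1 : p < 1) (h : List Bool) : IsPriorDensity β (densityAt β p ρ₀ h) := by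
  induction h with
  | nil => exact hρ
  | cons b t ih => exact ih.update hβ h0 h1 b

section Tree

variable {Ω : Type*} {η p β θs : ℝ} {d : ℝ → ℝ → ℝ} {cm cp ρ₀ : ℝ → ℝ} {ξ : ℕ → ℕ → Bool → Ω → ℝ}

lemma run_of_reached {ω : Ω} {h : List Bool}
    (hω : ω ∈ reached (outcomeAfter η p β d θs cm cp ρ₀ ξ) h) :
    run η p β d θs cm cp ρ₀ (fun k i s => ξ k i s ω) h.length = ⟨densityAt β p ρ₀ h, True⟩ := by
  induction h with
  | nil => rfl
  | cons b t ih =>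
    have hv : verdict η (fun i => answer d θs cm cp (median β (densityAt β p ρ₀ t))
      (fun s => ξ t.length i s ω)) = signOf b := hω.2
    rw [List.length_cons, run, ih hω.1, step]
    simp only
    rw [hv, if_pos ⟨trivial, by cases b <;> decide⟩]
    rfl

/-- A run leaves the tree only when a test never ends, and the hypothesis allows this only at the
true parameter, where the run then stays. -/
lemma reached_or_stopped {ω : Ω}
    (hω : ∀ h, median β (densityAt β p ρ₀ h) ≠ θs → ω ∈ outcomeAfter η p β d θs cm cp ρ₀ ξ h true ∨
      ω ∈ outcomeAfter η p β d θs cm cp ρ₀ ξ h false) (k : ℕ) :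
    (∃ h ∈ paths k, ω ∈ reached (outcomeAfter η p β d θs cm cp ρ₀ ξ) h) ∨
      (¬ (run η p β d θs cm cp ρ₀ (fun k i s => ξ k i s ω) k).running ∧
        query η p β d θs cm cp ρ₀ (fun k i s => ξ k i s ω) k = θs) := by
  induction k with
  | zero => exact Or.inl ⟨[], by simp [paths], trivial⟩
  | succ k ih =>
    rcases ih with ⟨h, hk, hr⟩ | ⟨h1, h2⟩
    · rw [mem_paths] at hk
      by_cases ht : ∃ b, ω ∈ outcomeAfter η p β d θs cm cp ρ₀ ξ h b
      · obtain ⟨b, hb⟩ := ht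
        exact Or.inl ⟨b :: h, by rw [mem_paths, List.length_cons, hk], hr, hb⟩
      · right
        have hrun := run_of_reached hr
        have hθ : median β (densityAt β p ρ₀ h) = θs := by
          by_contra hne
          rcases hω h hne with h' | h'
          · exact ht ⟨_, h'⟩
          · exact ht ⟨_, h'⟩
        have hz : verdict η (fun i => answer d θs cm cp (median β (densityAt β p ρ₀ h))
            (fun s => ξ h.length i s ω)) = 0 := by
          have ht1 : verdict η _ ≠ 1 := fun h' => ht ⟨true, h'⟩
          have ht2 : verdict η _ ≠ -1 := fun h' => ht ⟨false, h'⟩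
          revert ht1 ht2
          generalize verdict η (fun i => answer d θs cm cp (median β (densityAt β p ρ₀ h))
            (fun s => ξ h.length i s ω)) = v
          revert v; decide
        have : run η p β d θs cm cp ρ₀ (fun k i s => ξ k i s ω) (k + 1)
            = ⟨densityAt β p ρ₀ h, False⟩ := by
          rw [run, ← hk, hrun, step]
          simp only
          rw [hz, if_neg (by simp)]
        rw [query, this]
        exact ⟨id, hθ⟩
    · right
      have : run η p β d θs cm cp ρ₀ (fun k i s => ξ k i s ω) (k + 1)
          = ⟨(run η p β d θs cm cp ρ₀ (fun k i s => ξ k i s ω) k).density, False⟩ := by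
        rw [run, step]
        exact if_neg fun h => h1 h.1
      rw [query, this]
      exact ⟨id, h2⟩

lemma measurableSet_reached (h : List Bool) :
    MeasurableSet[noiseAlgebra ξ {j | j.1 < h.length}]
      (reached (outcomeAfter η p β d θs cm cp ρ₀ ξ) h) := by
  induction h with
  | nil => exact MeasurableSet.univ
  | cons b t ih =>
    refine MeasurableSet.inter ?_ ?_
    · exact noiseAlgebra_mono ξ (fun j (hj : j.1 < t.length) => show j.1 < (b :: t).length by
        rw [List.length_cons]; omega) _ ih
    · exact noiseAlgebra_mono ξ (fun j (hj : j.1 = t.length) => show j.1 < (b :: t).length by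
        rw [List.length_cons]; omega) _ (measurableSet_outcome ξ t.length b)

/-- A history fixes the next query point and involves only the noise of earlier tests, so the next
verdict is independent of it and no conditioning is needed. -/
lemma measureReal_reached_cons [MeasurableSpace Ω] {P : Measure Ω}
    (mξ : ∀ k i s, Measurable (ξ k i s))
    (hind : iIndepFun (fun j : ℕ × ℕ × Bool => ξ j.1 j.2.1 j.2.2) P) (b : Bool) (h : List Bool) :
    P.real (reached (outcomeAfter η p β d θs cm cp ρ₀ ξ) (b :: h))
      = P.real (reached (outcomeAfter η p β d θs cm cp ρ₀ ξ) h)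
        * P.real (outcomeAfter η p β d θs cm cp ρ₀ ξ h b) := by
  rw [reached, Measure.real, Measure.real, Measure.real, ← ENNReal.toReal_mul]
  congr 1
  refine measure_inter_eq_mul_of_disjoint (fun j : ℕ × ℕ × Bool => mξ j.1 j.2.1 j.2.2) hind ?_
    (measurableSet_reached h) (measurableSet_outcome ξ h.length b)
  rw [Set.disjoint_left]
  intro j (h1 : j.1 < h.length) (h2 : j.1 = h.length)
  omega

end Tree

/-! ### Decay of the expected potential along the tree and tail probabilities. -/

lemma sum_paths_le_pow {W : List Bool → ℝ} {lam : ℝ} (hl : 0 ≤ lam)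
    (h : ∀ t, W (true :: t) + W (false :: t) ≤ lam * W t) (k : ℕ) :
    ∑ t ∈ paths k, W t ≤ lam ^ k * W [] := by
  induction k with
  | zero => simp [paths]
  | succ k ih =>
    rw [sum_paths_succ]
    calc _ ≤ ∑ t ∈ paths k, lam * W t := Finset.sum_le_sum fun t _ => h t
      _ = lam * ∑ t ∈ paths k, W t := by rw [Finset.mul_sum]
      _ ≤ lam * (lam ^ k * W []) := mul_le_mul_of_nonneg_left ih hl
      _ = _ := by ring

open Classical in
/-- The contraction of the potential bounds the probability of the tail of the bisection. -/
lemma sum_paths_tail_le {p e ε δ δ' c ν : ℝ} (hp : 1 / 2 < p) (hp1 : p < 1) (hδ : 0 ≤ δ)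
    (hδ1 : δ ≤ 1) (hδ' : 0 ≤ δ') (hδ'1 : δ' ≤ 1 / 2) (hν : 0 < ν)
    (hcon : ∀ s t x y : ℝ, 0 ≤ s → s < t → t ≤ 1 → 0 ≤ x → 0 ≤ y → x + y ≤ 1 →
        (1 / 2 < t → y ≤ e ∧ ε ≤ y) → (t = 1 / 2 → x ≤ e ∧ y ≤ e) → (t < 1 / 2 → x ≤ e) →
        x * potential δ δ' c (push (1 - p) s) (push (1 - p) t)
          + y * potential δ δ' c (push p s) (push p t) ≤ ν ^ 4 * potential δ δ' c s t)
    {s t W : List Bool → ℝ} {π : List Bool → Bool → ℝ} {up : Bool}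
    (hW : ∀ h b, W (b :: h) = W h * π h b) (hW0 : ∀ h, 0 ≤ W h) (hW1 : W [] = 1)
    (hs : ∀ h b, s (b :: h) = push (if b = up then 1 - p else p) (s h))
    (ht : ∀ h b, t (b :: h) = push (if b = up then 1 - p else p) (t h))
    (hs0 : 0 ≤ s []) (ht1 : t [] ≤ 1) {m : ℝ} (hm : 0 < m) (hst : m ≤ t [] - s [])
    (hπ0 : ∀ h b, 0 ≤ π h b) (hπ1 : ∀ h, π h up + π h (!up) ≤ 1)
    (H1 : ∀ h, 1 / 2 < t h → π h (!up) ≤ e ∧ ε ≤ π h (!up))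
    (H2 : ∀ h, t h = 1 / 2 → π h up ≤ e ∧ π h (!up) ≤ e)
    (H3 : ∀ h, t h < 1 / 2 → π h up ≤ e) (k : ℕ) :
    (∑ h ∈ paths k, if 1 / 2 ≤ s h then W h else 0) ≤ 2 * ν ^ (4 * k) / m ^ 2 := by
  have hp0 : 0 < p := by linarith
  have hr : ∀ b : Bool, 0 < (if b = up then 1 - p else p) ∧ (if b = up then 1 - p else p) < 1 := by
    intro b; split_ifs <;> constructor <;> linarith
  have hall : ∀ h, 0 ≤ s h ∧ s h < t h ∧ t h ≤ 1 := by
    intro h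
    induction h with
    | nil => exact ⟨hs0, by linarith, ht1⟩
    | cons b h ih =>
      rw [hs, ht]
      exact ⟨push_nonneg (hr b).1 (hr b).2 ih.1, push_lt_push (hr b).1 (hr b).2 ih.2.1,
        push_le_one (hr b).1 (hr b).2 ih.2.2⟩
  have hstep : ∀ h, W (true :: h) * potential δ δ' c (s (true :: h)) (t (true :: h))
      + W (false :: h) * potential δ δ' c (s (false :: h)) (t (false :: h))
      ≤ ν ^ 4 * (W h * potential δ δ' c (s h) (t h)) := by
    intro h
    obtain ⟨a1, a2, a3⟩ := hall h
    have key := mul_le_mul_of_nonneg_left (hcon (s h) (t h) (π h up) (π h (!up)) a1 a2 a3 (hπ0 h _)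
      (hπ0 h _) (hπ1 h) (H1 h) (H2 h) (H3 h)) (hW0 h)
    simp only [hW, hs, ht]
    cases up <;> simp at key ⊢ <;> linarith
  have hsum := sum_paths_le_pow (W := fun h => W h * potential δ δ' c (s h) (t h))
    (by positivity) hstep k
  -- In the tail the ratio is at least `1` and the discount is at most `1 / 2`; with Markov's
  -- inequality this produces the factor `2`.
  have hφ : ∀ h, 0 ≤ potential δ δ' c (s h) (t h) ∧
      (1 / 2 ≤ s h → 1 / 2 ≤ potential δ δ' c (s h) (t h)) := by
    intro h
    obtain ⟨a1, a2, a3⟩ := hall h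
    have b1 := le_potential (c := c) a1 a2 a3 hδ hδ'
    have b2 : 0 ≤ s h / (t h - s h) := div_nonneg a1 (by linarith)
    refine ⟨(mul_nonneg b2 (by linarith)).trans b1, fun b3 => le_trans ?_ b1⟩
    have b4 : 1 ≤ s h / (t h - s h) := by rw [le_div_iff₀ (by linarith)]; linarith
    nlinarith
  -- One factor `1 / m` bounds the ratio and the other bounds the correction, which is at most `1 /
  -- t` because `δ ≤ 1`.
  have h0 : potential δ δ' c (s []) (t []) ≤ 1 / m ^ 2 := by
    obtain ⟨a1, a2, a3⟩ := hall []
    refine (potential_le a1 a2 hδ').trans ?_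
    have b1 : s [] / (t [] - s []) ≤ 1 / m :=
      div_le_div₀ zero_le_one (by linarith) hm hst
    have b2 : 1 ≤ 1 / t [] := (one_le_div (by linarith)).2 a3
    have b3 : 1 / t [] ≤ 1 / m := one_div_le_one_div_of_le hm (by linarith)
    have b4 : 1 + δ * (1 / t [] - 1) ≤ 1 / m := by nlinarith
    calc _ ≤ 1 / m * (1 / m) :=
          mul_le_mul b1 b4 (by nlinarith) (by positivity)
      _ = _ := by ring
  rw [hW1, one_mul] at hsum
  calc (∑ h ∈ paths k, if 1 / 2 ≤ s h then W h else 0)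
      ≤ ∑ h ∈ paths k, 2 * (W h * potential δ δ' c (s h) (t h)) := by
        refine Finset.sum_le_sum fun h _ => ?_
        obtain ⟨b1, b2⟩ := hφ h
        split_ifs with hh
        · have := mul_le_mul_of_nonneg_left (b2 hh) (hW0 h); linarith
        · have := mul_nonneg (hW0 h) b1; linarith
    _ ≤ 2 * ((ν ^ 4) ^ k * (1 / m ^ 2)) := by
        rw [← Finset.mul_sum]
        refine mul_le_mul_of_nonneg_left (hsum.trans ?_) (by norm_num)
        exact mul_le_mul_of_nonneg_left h0 (by positivity)
    _ = _ := by rw [← pow_mul]; ring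

/-- The probability that the query point is in a tail, in terms of the tree of the runs. -/
lemma measure_query_le {Ω : Type*} [MeasurableSpace Ω] {P : Measure Ω} [IsProbabilityMeasure P]
    {η p β θs : ℝ} {d : ℝ → ℝ → ℝ} {cm cp ρ₀ : ℝ → ℝ} {ξ : ℕ → ℕ → Bool → Ω → ℝ}
    (hae : ∀ᵐ ω ∂P, ∀ h, median β (densityAt β p ρ₀ h) ≠ θs →
      ω ∈ outcomeAfter η p β d θs cm cp ρ₀ ξ h true ∨
      ω ∈ outcomeAfter η p β d θs cm cp ρ₀ ξ h false)
    {S : Set ℝ} (hθ : θs ∈ S) {s : List Bool → ℝ}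
    (hs : ∀ h, median β (densityAt β p ρ₀ h) ∉ S → 1 / 2 ≤ s h) {k : ℕ} {B : ℝ}
    (hB : (open Classical in ∑ h ∈ paths k, if 1 / 2 ≤ s h
      then P.real (reached (outcomeAfter η p β d θs cm cp ρ₀ ξ) h) else 0) ≤ B) :
    P {ω | query η p β d θs cm cp ρ₀ (fun k i s => ξ k i s ω) k ∉ S} ≤ ENNReal.ofReal B := by
  classical
  have hsub : ∀ᵐ ω ∂P, ω ∈ {ω | query η p β d θs cm cp ρ₀ (fun k i s => ξ k i s ω) k ∉ S} →
      ω ∈ ⋃ h ∈ (paths k).filter (fun h => 1 / 2 ≤ s h),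
        reached (outcomeAfter η p β d θs cm cp ρ₀ ξ) h := by
    filter_upwards [hae] with ω hω
    intro (hq : query η p β d θs cm cp ρ₀ (fun k i s => ξ k i s ω) k ∉ S)
    rcases reached_or_stopped hω k with ⟨h, hk, hr⟩ | ⟨-, h2⟩
    · have hrun := run_of_reached hr
      rw [mem_paths.1 hk] at hrun
      rw [query, hrun] at hq
      exact mem_iUnion₂.2 ⟨h, Finset.mem_filter.2 ⟨hk, hs h hq⟩, hr⟩
    · rw [h2] at hq
      exact absurd hθ hq
  refine (measure_mono_ae hsub).trans ((measure_biUnion_finset_le _ _).trans ?_)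
  rw [← Finset.sum_filter] at hB
  refine le_trans (le_of_eq ?_) (ENNReal.ofReal_le_ofReal hB)
  rw [ENNReal.ofReal_sum_of_nonneg fun h _ => measureReal_nonneg]
  exact Finset.sum_congr rfl fun h _ => (ofReal_measureReal).symm


/-! ### Both tails together. -/

/-- The expected exit time is bounded in terms of the prior mass near the true parameter. -/
lemma lintegral_exitTime_le {η p ε δ δ' c ν : ℝ} (hp : 1 / 2 < p) (hp1 : p < 1) (hδ : 0 ≤ δ)
    (hδ1 : δ ≤ 1) (hδ' : 0 ≤ δ') (hδ'1 : δ' ≤ 1 / 2) (hν : 0 < ν) (hν1 : ν < 1)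
    (hcon : ∀ s t x y : ℝ, 0 ≤ s → s < t → t ≤ 1 → 0 ≤ x → 0 ≤ y → x + y ≤ 1 →
        (1 / 2 < t → y ≤ η / 2 ∧ ε ≤ y) → (t = 1 / 2 → x ≤ η / 2 ∧ y ≤ η / 2) →
        (t < 1 / 2 → x ≤ η / 2) →
        x * potential δ δ' c (push (1 - p) s) (push (1 - p) t)
          + y * potential δ δ' c (push p s) (push p t) ≤ ν ^ 4 * potential δ δ' c s t)
    {θs β a m : ℝ} {d : ℝ → ℝ → ℝ} {cm cp ρ₀ : ℝ → ℝ} (hθ : 0 < θs) (hθβ : θs ≤ β)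
    (hρ : IsPriorDensity β ρ₀)
    {Ω : Type*} [MeasurableSpace Ω] {P : Measure Ω} [IsProbabilityMeasure P]
    {ξ : ℕ → ℕ → Bool → Ω → ℝ} (mξ : ∀ k i s, Measurable (ξ k i s))
    (hind : iIndepFun (fun j : ℕ × ℕ × Bool => ξ j.1 j.2.1 j.2.2) P)
    (hO : ∀ k, ∀ x ∈ Icc (-β) β, OutcomeBounds P (outcome η d θs cm cp ξ k x) (η / 2) ε x θs)
    (ha : 0 < a) (haβ : a < θs + β) (hm : 0 < m)
    (hleft : ENNReal.ofReal m ≤ densityMeasure β ρ₀ (Ioc (θs - a) θs))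
    (hright : θs + a ≤ β → ENNReal.ofReal m ≤ densityMeasure β ρ₀ (Ico θs (θs + a))) :
    ∫⁻ ω, exitTime β θs a (query η p β d θs cm cp ρ₀ (fun k i s => ξ k i s ω)) ∂P
      ≤ ENNReal.ofReal (2 * (2 / (1 - ν ^ 4) / (1 - ν)) * (1 / Real.sqrt m)) := by
  have hβ : 0 < β := by linarith
  have hp0 : 0 < p := by linarith
  have hdens : ∀ h, IsPriorDensity β (densityAt β p ρ₀ h) := isPriorDensity_densityAt hρ hβ hp0 hp1
  have hmed : ∀ h, median β (densityAt β p ρ₀ h) ∈ Icc (-β) β := fun h =>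
    ((hdens h).median_spec hβ).1
  have hθI : θs ∈ Icc (-β) β := ⟨by linarith, hθβ⟩
  have hmass : ∀ h b y, massBelow β (densityAt β p ρ₀ (b :: h)) y
      = push (leftFactor p b) (massBelow β (densityAt β p ρ₀ h) y) := fun h b y =>
    (hdens h).measureReal_update hβ hp0 hp1 b y
  have hOB : ∀ h, OutcomeBounds P (outcomeAfter η p β d θs cm cp ρ₀ ξ h) (η / 2) ε
      (median β (densityAt β p ρ₀ h)) θs := fun h => hO _ _ (hmed h)
  have hlt : ∀ h, median β (densityAt β p ρ₀ h) < θs ↔ 1 / 2 < massBelow β (densityAt β p ρ₀ h) θs :=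
    fun h => by
      rw [← not_le, ← not_le, (hdens h).le_median_iff hβ hθI]
  have hgt : ∀ h, θs < median β (densityAt β p ρ₀ h) ↔ massBelow β (densityAt β p ρ₀ h) θs < 1 / 2 :=
    fun h => by
      rw [← not_le, ← not_le, (hdens h).median_le_iff hβ hθI]
  have heq : ∀ h, massBelow β (densityAt β p ρ₀ h) θs = 1 / 2 → median β (densityAt β p ρ₀ h) = θs :=
    fun h hh => le_antisymm (((hdens h).median_le_iff hβ hθI).2 hh.ge)
      (((hdens h).le_median_iff hβ hθI).2 hh.le)
  have hae : ∀ᵐ ω ∂P, ∀ h, median β (densityAt β p ρ₀ h) ≠ θs →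
      ω ∈ outcomeAfter η p β d θs cm cp ρ₀ ξ h true ∨
      ω ∈ outcomeAfter η p β d θs cm cp ρ₀ ξ h false := by
    refine ae_all_iff.2 fun h => ?_
    by_cases hne : median β (densityAt β p ρ₀ h) = θs
    · exact Filter.Eventually.of_forall fun ω hω => absurd hne hω
    · rcases lt_or_gt_of_ne hne with hl | hl
      · exact ((hOB h).left hl).2.2.mono fun ω hω _ => hω
      · exact ((hOB h).right hl).2.2.mono fun ω hω _ => hω
  have hprob := hρ.isProbabilityMeasure
  have hW := fun h b => measureReal_reached_cons (η := η) (p := p) (β := β) (θs := θs) (d := d)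
    (cm := cm) (cp := cp) (ρ₀ := ρ₀) mξ hind b h
  have hW0 : P.real (reached (outcomeAfter η p β d θs cm cp ρ₀ ξ) []) = 1 := by
    rw [reached]; exact probReal_univ
  have hL : ∀ k, P {ω | query η p β d θs cm cp ρ₀ (fun k i s => ξ k i s ω) k
      ∉ Ioc (θs - a) θs ∪ Ioc θs β} ≤ ENNReal.ofReal (2 * ν ^ (4 * k) / m ^ 2) := by
    intro k
    have hst : m ≤ massBelow β ρ₀ θs - massBelow β ρ₀ (θs - a) := by
      rw [← hρ.measureReal_Ioc (by linarith)]
      exact (ENNReal.ofReal_le_iff_le_toReal (measure_ne_top _ _)).1 hleft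
    refine measure_query_le hae (Or.inl ⟨by linarith, le_rfl⟩)
      (s := fun h => massBelow β (densityAt β p ρ₀ h) (θs - a)) (fun h hh => ?_)
      (sum_paths_tail_le (up := true) (t := fun h => massBelow β (densityAt β p ρ₀ h) θs)
        hp hp1 hδ hδ1 hδ' hδ'1 hν hcon hW
        (fun _ => measureReal_nonneg) hW0 (fun h b => ?_) (fun h b => ?_) (massBelow_nonneg _ _ _)
        (hρ.massBelow_le_one _) hm hst (fun _ _ => measureReal_nonneg) (fun h => (hOB h).add_le)
        (fun h hh => ?_) (fun h hh => (hOB h).center (heq h hh))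
        (fun h hh => ((hOB h).right ((hgt h).2 hh)).1) k)
    · rw [← (hdens h).median_le_iff hβ ⟨by linarith, by linarith⟩]
      by_contra hlt
      push Not at hlt
      rcases le_or_gt (median β (densityAt β p ρ₀ h)) θs with h' | h'
      · exact hh (Or.inl ⟨hlt, h'⟩)
      · exact hh (Or.inr ⟨h', (hmed h).2⟩)
    · rw [hmass]; rfl
    · rw [hmass]; rfl
    · have := (hOB h).left ((hlt h).2 hh)
      exact ⟨this.1, this.2.1⟩
  have hR : ∀ k, P {ω | query η p β d θs cm cp ρ₀ (fun k i s => ξ k i s ω) k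
      ∉ (Icc (θs + a) β)ᶜ} ≤ ENNReal.ofReal (2 * ν ^ (4 * k) / m ^ 2) := by
    intro k
    -- When the right tail is empty there is no prior mass assumption on that side, and none is
    -- needed.
    rcases lt_or_ge β (θs + a) with hb | hb
    · simp [Icc_eq_empty (not_le.2 hb)]
    have hst : m ≤ (1 - massBelow β ρ₀ θs) - (1 - massBelow β ρ₀ (θs + a)) := by
      have h1 := (ENNReal.ofReal_le_iff_le_toReal (measure_ne_top _ _)).1 (hright hb)
      have h2 : (densityMeasure β ρ₀).real (Ico θs (θs + a))
          = (densityMeasure β ρ₀).real (Ioc θs (θs + a)) := measureReal_congr Ico_ae_eq_Ioc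
      have h3 := hρ.measureReal_Ioc (by linarith : θs ≤ θs + a)
      change m ≤ (densityMeasure β ρ₀).real _ at h1
      linarith
    -- Reflection of the line: masses above a point evolve by `push` as well, with the verdicts
    -- exchanged, hence `up := false` below.
    have hpush : ∀ (b : Bool) (y : ℝ), 1 - push (leftFactor p b) y
        = push (if b = false then 1 - p else p) (1 - y) := by
      intro b y
      rcases le_total y (1 / 2) with hy | hy
      · rw [push_of_le hy, push_of_ge (by linarith)]
        cases b <;> simp [leftFactor] <;> ring
      · rw [push_of_ge hy, push_of_le (by linarith)]
        cases b <;> simp [leftFactor] <;> ring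
    refine measure_query_le hae (fun hh => absurd hh.1 (by linarith))
      (s := fun h => 1 - massBelow β (densityAt β p ρ₀ h) (θs + a)) (fun h hh => ?_)
      (sum_paths_tail_le (up := false) (t := fun h => 1 - massBelow β (densityAt β p ρ₀ h) θs)
        hp hp1 hδ hδ1 hδ' hδ'1 hν hcon hW
        (fun _ => measureReal_nonneg) hW0 (fun h b => ?_) (fun h b => ?_)
        (sub_nonneg.2 (hρ.massBelow_le_one _))
        (sub_le_self _ (massBelow_nonneg _ _ _)) hm hst (fun _ _ => measureReal_nonneg)
        (fun h => ?_) (fun h hh => ?_) (fun h hh => ((hOB h).center (heq h ?_)).symm)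
        (fun h hh => ((hOB h).left ((hlt h).2 ?_)).1) k)
    · have := ((hdens h).le_median_iff hβ ⟨by linarith, hb⟩).1 (not_not.1 hh).1
      linarith
    · rw [hmass, hpush]
    · rw [hmass, hpush]
    · rw [add_comm]; exact (hOB h).add_le
    · have := (hOB h).right ((hgt h).2 (by linarith))
      exact ⟨this.1, this.2.1⟩
    · linarith
    · linarith
  have h4 : ν ^ 4 < 1 := pow_lt_one₀ hν.le hν1 (by norm_num)
  have hB : 0 ≤ 2 / (1 - ν ^ 4) / (1 - ν) * (1 / Real.sqrt m) := by
    have := sub_pos.2 h4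
    have := sub_pos.2 hν1
    positivity
  obtain ⟨f, hf, hf1, hf2⟩ := exists_settleTime_le hν hν1 hm hL
  obtain ⟨g, -, hg1, hg2⟩ := exists_settleTime_le hν hν1 hm hR
  rw [mul_assoc, two_mul, ENNReal.ofReal_add hB hB]
  calc _ ≤ ∫⁻ ω, f ω + g ω ∂P := lintegral_mono fun ω =>
        max_le ((hf1 ω).trans le_self_add) ((hg1 ω).trans le_add_self)
    _ = ∫⁻ ω, f ω ∂P + ∫⁻ ω, g ω ∂P := lintegral_add_left hf _
    _ ≤ _ := add_le_add hf2 hg2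

end BisectionMedians

/-! ### Choice of the constants and the final inequality. -/

theorem mainTheorem8 (η p : ℝ) (hη₀ : 0 < η) (hη₁ : η < 1) (hp : 1 / 2 < p)
    (hpc : p < 1 - η / 2) :
    ∃ r₂ : ℝ, 0 < r₂ ∧
    ∀ Δ γ : ℝ, 0 < Δ → 0 < γ →
    ∃ r₁ rR α : ℝ, 0 < r₁ ∧ 0 < rR ∧ 0 < α ∧
    ∀ θs : ℝ, 0 < θs →
    ∃ β₁ β₂ : ℝ, 0 < β₁ ∧ 0 < β₂ ∧
    ∀ (β : ℝ) (d : ℝ → ℝ → ℝ) (cm cp ρ₀ : ℝ → ℝ),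
      θs ≤ β →
      BisectionMedians.IsDistance d →
      BisectionMedians.IsComparisonPair d Δ β cm cp →
      BisectionMedians.IsPriorDensity β ρ₀ →
    ∀ (Ω : Type*) [MeasurableSpace Ω] (P : Measure Ω) [IsProbabilityMeasure P]
      (ξ : ℕ → ℕ → Bool → Ω → ℝ),
      (∀ k i s, Measurable (ξ k i s)) →
      iIndepFun (fun j : ℕ × ℕ × Bool => ξ j.1 j.2.1 j.2.2) P →
      (∀ k i s, BisectionMedians.IsGumbel P γ (ξ k i s)) →
    ∀ a ς : ℝ, 0 < a → a < θs + β → ς ≤ 1 →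
      ENNReal.ofReal (a ^ ς) ≤ BisectionMedians.densityMeasure β ρ₀ (Ioc (θs - a) θs) →
      (θs + a ≤ β →
        ENNReal.ofReal (a ^ ς) ≤ BisectionMedians.densityMeasure β ρ₀ (Ico θs (θs + a))) →
      ∫⁻ ω, BisectionMedians.exitTime β θs a
          (BisectionMedians.query η p β d θs cm cp ρ₀ (fun k i s => ξ k i s ω)) ∂P
        ≤ ENNReal.ofReal (4 * θs / (r₂ * α * a ^ ς) + 4 * β₁ / r₁ + 2 * β₂ / rR) := by
  obtain ⟨n, hn, hb⟩ := BisectionMedians.exists_boundary_le hη₀ hη₁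
  refine ⟨1, one_pos, fun Δ γ hΔ hγ => ?_⟩
  obtain ⟨δ, δ', c, ν, hδ, hδ1, hδ', hδ'1, hν, hν1, hcon⟩ :=
    BisectionMedians.exists_potential_contract (ε := (Real.exp (-1) *
      (1 - Real.exp (-Real.exp (-Δ / γ)))) ^ n) hp (half_pos hη₀) hpc
      (pow_pos BisectionMedians.gap_pos n)
  have h4 : 0 < 1 - ν ^ 4 := sub_pos.2 (pow_lt_one₀ hν.le hν1 (by norm_num))
  have h1 : 0 < 1 - ν := sub_pos.2 hν1
  set C := 2 / (1 - ν ^ 4) / (1 - ν) with hC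
  have hC0 : 0 < C := by positivity
  -- The aim is the bound `2 * C * (θs / a ^ ς + 1 / θs)`: `α = 2 / C` yields its first summand and
  -- `β₁ = C / (2 * θs)` its second. The term with `β₂` is slack.
  refine ⟨1, 1, 2 / C, one_pos, one_pos, by positivity, fun θs hθ => ?_⟩
  refine ⟨C / (2 * θs), 1, by positivity, one_pos, ?_⟩
  intro β d cm cp ρ₀ hθβ hd hc hρ Ω _ P _ ξ mξ hind hξ a ς ha haβ _ hleft hright
  have hm : 0 < a ^ ς := Real.rpow_pos_of_pos ha ς
  refine (BisectionMedians.lintegral_exitTime_le hp (by linarith) hδ hδ1 hδ' hδ'1 hν hν1 hcon hθ hθβ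
    hρ mξ hind (fun k x hx => BisectionMedians.outcomeBounds hη₀ hη₁ hΔ hγ hd hc mξ hind hξ hn hb hx k)
    ha haβ hm hleft hright).trans (ENNReal.ofReal_le_ofReal ?_)
  rw [← hC]
  have hs : 0 < Real.sqrt (a ^ ς) := Real.sqrt_pos.2 hm
  have hsq : (1 / Real.sqrt (a ^ ς)) ^ 2 = 1 / a ^ ς := by
    rw [div_pow, one_pow, Real.sq_sqrt hm.le]
  -- Completing the square in `1 / √(a ^ ς)`; this is where the factor `θs` of the stated bound
  -- enters.
  have key : 1 / Real.sqrt (a ^ ς) ≤ θs * (1 / a ^ ς) + 1 / θs := by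
    rw [← hsq]
    have e : θs * (1 / Real.sqrt (a ^ ς)) ^ 2 + 1 / θs - 1 / Real.sqrt (a ^ ς)
        = (θs * (1 / Real.sqrt (a ^ ς)) - 1 / 2) ^ 2 / θs + 3 / (4 * θs) := by
      field_simp; ring
    have : 0 ≤ (θs * (1 / Real.sqrt (a ^ ς)) - 1 / 2) ^ 2 / θs + 3 / (4 * θs) := by positivity
    linarith
  calc 2 * C * (1 / Real.sqrt (a ^ ς)) ≤ 2 * C * (θs * (1 / a ^ ς) + 1 / θs) :=
        mul_le_mul_of_nonneg_left key (by positivity)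
    _ = 4 * θs / (1 * (2 / C) * a ^ ς) + 4 * (C / (2 * θs)) / 1 := by field_simp; ring
    _ ≤ _ := by linarith
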